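/- **Setting.** Let $K\subset\mathbb{R}^n$ be compact and convex with at least two points, let $d=\operatorname{diam}(K)$ (Euclidean norm), and let $\sigma>0$. For $Y=\mu+\xi$ with $\mu\in K$ and $\xi\sim N(0,\sigma^2\mathbb{I}_n)$ let $\hat\mu=\operatorname{argmin}_{\nu\in K}\|Y-\nu\|^2$ be the least squares estimator and let $\varepsilon_K(\sigma)=\big(\sup_{\mu\in K}\mathbb{E}\|\hat\mu-\mu\|^2\big)^{1/2}$. Write $B(\mu,r)$ for the closed ball, $w_\mu(r)=\mathbb{E}\sup_{t\in B(\mu,r)\cap K}\langle x,t\rangle$ with $x\sim N(0,\mathbb{I}_n)$, and $M(\delta,T)$ for the largest cardinality of a $\delta$-packing of $T$, i.e. of a subset of $T$ whose points have pairwise distances $>\delta$. Fix constants $c^*>1$ and $L>0$, set $C=8+8/c^*$ and $$M^{\mathrm{loc}}(\varepsilon)=\sup_{\theta\in K}M\big(\varepsilon/c^*,B(\theta,\varepsilon)\cap K\big),\qquad \underline\varepsilon^*=\sup\Big\{\varepsilon>0:\ \frac{C^2\varepsilon^2}{4\sigma^2}\le \Big(\frac{L}{c^*}\Big)^2\log M^{\mathrm{loc}}(\varepsilon)\Big\}.$$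 **Algorithm (global packing).** Initialize $\varepsilon\leftarrow 2\underline\varepsilon^*$. For the current $\varepsilon$ put $$\delta=\frac{\varepsilon^3}{4c^*\,\sigma\,\sup_{\eta\in K}w_\eta(\varepsilon/c^*)}\wedge\varepsilon ,$$ form a $\delta$-packing set $\{\nu_1,\dots,\nu_M\}$ of $K$ with $M=M(\delta,K)$, and put $$\Psi=\max_{i\le M}\ \Big(\sup_{\nu'\in B(\nu_i,2\varepsilon-\delta)\cap K}w_{\nu'}(\varepsilon/c^*)-w_{\nu_i}(\varepsilon/c^*)\Big),\qquad T=\frac{C\varepsilon^2}{2\sigma}-\frac{L}{c^*}\,\varepsilon\sqrt{\log M^{\mathrm{loc}}(\varepsilon)} .$$ While $\Psi\ge T$, replace $\varepsilon$ by $2\varepsilon$ and recompute $\delta$, the packing set, $\Psi$ and $T$. When $\Psi<T$, return $\varepsilon$. It *terminates on initialization* if $\Psi<T$ already holds for $\varepsilon=2\underline\varepsilon^*$. **Theorem.** For every choice of the packing sets, the algorithm can be executed and terminates after finitely many steps. Its output $\varepsilon$ satisfies the following, where for each $a>0$ the condition $d\lesssim\sigma$ means $d\le a\sigma$ and $d\gtrsim\sigma$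 means $\sigma\le a d$; the constants hidden in the conclusions (1)–(3) depend only on $a,c^*,L$, those in (4) only on $c^*,L$, and none of them on $n$, $K$, $\sigma$ or the packing sets. 1. If $d\lesssim\sigma$, then $\varepsilon_K(\sigma)\asymp d\lesssim\varepsilon$. 2. If $d\gtrsim\sigma$ and $\sigma\ge\varepsilon$, then $\varepsilon\asymp\varepsilon_K(\sigma)\asymp\sigma\wedge d$. 3. If $d\gtrsim\sigma$ and $\sigma\le\varepsilon$, then $\varepsilon\asymp\varepsilon_K(\sigma)$. 4. If the algorithm terminates on initialization, then $\varepsilon\asymp\varepsilon_K(\sigma)$. -/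

import Mathlib

open MeasureTheory ProbabilityTheory
open scoped ENNReal

noncomputable section

namespace LSEPacking

/-- `ℝⁿ` with the Euclidean norm. -/
abbrev E (n : ℕ) : Type := EuclideanSpace ℝ (Fin n)

/-- `a ≍ b` with the explicit constant `A`, that is `a ≤ A b` and `b ≤ A a`. -/
def Comparable (A a b : ℝ) : Prop := a ≤ A * b ∧ b ≤ A * a

variable {n : ℕ}

/-- The least squares estimator, `argmin_{ν ∈ K} ‖y - ν‖²` (for nonempty closed convex `K` this
minimizer exists and is unique). -/
def lse (K : Set (E n)) (y : E n) : E n :=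
  Classical.epsilon fun v => v ∈ K ∧ ∀ ν ∈ K, ‖y - v‖ ^ 2 ≤ ‖y - ν‖ ^ 2

/-- The risk `𝔼 ‖μ̂(Y) - μ‖²` for `Y = μ + ξ`, with noise `ξ = σ x ~ N(0, σ² Iₙ)`. -/
def risk (K : Set (E n)) (σ : ℝ) (μ : E n) : ℝ :=
  ∫ x, ‖lse K (μ + σ • x) - μ‖ ^ 2 ∂(stdGaussian (E n))

/-- The worst case rate `ε_K(σ)`, with `ε_K(σ)² = sup_{μ ∈ K} 𝔼 ‖μ̂ - μ‖²`. -/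
def worstCaseRate (K : Set (E n)) (σ : ℝ) : ℝ :=
  Real.sqrt (⨆ μ : K, risk K σ μ)

/-- The Gaussian width `w(T) = 𝔼 sup_{t ∈ T} ⟨x, t⟩`, `x ~ N(0, Iₙ)`. -/
def gaussianWidth (T : Set (E n)) : ℝ :=
  ∫ x, (⨆ t : T, inner ℝ x (t : E n)) ∂(stdGaussian (E n))

/-- The local Gaussian width `w_μ(r) = w(B(μ, r) ∩ K)`. -/
def localWidth (K : Set (E n)) (μ : E n) (r : ℝ) : ℝ :=
  gaussianWidth (Metric.closedBall μ r ∩ K)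

/-- `M^loc(ε) = sup_{θ ∈ K} M(ε / c, B(θ, ε) ∩ K)`, where `M(δ, T)` is the largest cardinality of a
set of points of `T` with pairwise distances `> δ`. -/
def localPackingNumber (c : ℝ) (K : Set (E n)) (ε : ℝ) : ℕ∞ :=
  ⨆ θ ∈ K, Metric.packingNumber (ε / c).toNNReal (Metric.closedBall θ ε ∩ K)

/-- The local entropy `log M^loc(ε)` (for bounded `K` and `c, ε > 0`, `M^loc(ε)` is finite). -/
def localEntropy (c : ℝ) (K : Set (E n)) (ε : ℝ) : ℝ :=
  Real.log ((localPackingNumber c K ε).toNat : ℝ)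

/-- The constant `C = 8 + 8 / c`. -/
def constC (c : ℝ) : ℝ := 8 + 8 / c

/-- `sup {ε > 0 : C² ε² / (4 σ²) ≤ (L / c)² log M^loc(ε)}`. -/
def lowerRate (c L : ℝ) (K : Set (E n)) (σ : ℝ) : ℝ :=
  sSup {ε : ℝ | 0 < ε ∧
    constC c ^ 2 * ε ^ 2 / (4 * σ ^ 2) ≤ (L / c) ^ 2 * localEntropy c K ε}

/-- The packing radius
`δ = (ε³ / (4 c (sup_{η ∈ K} w_η(ε / c)) σ)) ∧ ε` used at the scale `ε`. -/
def packRadius (c : ℝ) (K : Set (E n)) (σ ε : ℝ) : ℝ :=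
  min (ε ^ 3 / (4 * c * (⨆ η : K, localWidth K η (ε / c)) * σ)) ε

/-- `P` is a maximal `δ`-packing set of `K`: a subset of `K` with pairwise distances `> δ` and with
exactly `M(δ, K)` elements. -/
def IsMaximalPacking (δ : ℝ) (K : Set (E n)) (P : Finset (E n)) : Prop :=
  (P : Set (E n)) ⊆ K ∧
    Metric.IsSeparated (ENNReal.ofReal δ) (P : Set (E n)) ∧
    (P.card : ℕ∞) = Metric.packingNumber δ.toNNReal K

/-- `Ψ = max_{ν ∈ P} (sup_{ν' ∈ B(ν, 2ε - δ) ∩ K} w_{ν'}(ε / c)) - w_ν(ε / c)`. -/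
def Psi (c : ℝ) (K : Set (E n)) (σ ε : ℝ) (P : Finset (E n)) : ℝ :=
  ⨆ ν : P,
    ((⨆ ν' : ↥(Metric.closedBall (ν : E n) (2 * ε - packRadius c K σ ε) ∩ K),
        localWidth K ν' (ε / c)) - localWidth K ν (ε / c))

/-- `T = C ε² / (2σ) - (L / c) ε √(log M^loc(ε))`. -/
def threshold (c L : ℝ) (K : Set (E n)) (σ ε : ℝ) : ℝ :=
  constC c * ε ^ 2 / (2 * σ) - L / c * ε * Real.sqrt (localEntropy c K ε)

/-- The states visited by the global packing algorithm when `P k` is the packing set that is formed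
after `k` passes through the `while` loop. `Visits c L K σ P k ε` says that the loop condition is
about to be tested for the `(k+1)`-st time, with `ε` the current value of the variable. The variable
starts at `2 * lowerRate` and is doubled as long as `Ψ ≥ T`. -/
inductive Visits (c L : ℝ) (K : Set (E n)) (σ : ℝ) (P : ℕ → Finset (E n)) : ℕ → ℝ → Prop
  | init : Visits c L K σ P 0 (2 * lowerRate c L K σ)
  | loop {k : ℕ} {ε : ℝ} : Visits c L K σ P k ε →
      threshold c L K σ ε ≤ Psi c K σ ε (P k) → Visits c L K σ P (k + 1) (2 * ε)

/-- The choices `P` of packing sets are legitimate: each one that the algorithm forms is a maximal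
packing set of `K` at the current radius `δ`. -/
def ValidPackings (c L : ℝ) (K : Set (E n)) (σ : ℝ) (P : ℕ → Finset (E n)) : Prop :=
  ∀ k ε, Visits c L K σ P k ε → IsMaximalPacking (packRadius c K σ ε) K (P k)

/-- The algorithm stops after exactly `k` passes through the loop and returns `ε`. The case `k = 0`
is termination on initialization. -/
def Returns (c L : ℝ) (K : Set (E n)) (σ : ℝ) (P : ℕ → Finset (E n)) (k : ℕ) (ε : ℝ) : Prop :=
  Visits c L K σ P k ε ∧ Psi c K σ ε (P k) < threshold c L K σ ε

end LSEPacking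

end

open MeasureTheory ProbabilityTheory
open scoped ENNReal

noncomputable section

namespace LSEPacking

variable {n : ℕ}

/-! Write ε* for `lowerRate`, R for `worstCaseRate` and d for the diameter. Three comparisons, with
constants depending only on `c` and `L`, carry the theorem.

(a) min(σ, d) ≲ ε* ≲ R. The first bound holds because two points of K already have entropy log 2
(`min_le_lowerRate`). The second is a Fano type argument: a local packing with large entropy cannot
be resolved at noise level σ (`le_worstCaseRate_of_packing`, `lowerRate_le_worstCaseRate`).

(b) If the loop stops at ε > ε*, then R ≲ ε + σ (`worstCaseRate_le_of_Psi_lt`). A small Ψ makes the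
widths at scale ε/c near a packing point ν almost equal to that at ν. One chaining step turns this
into w_ν(ε) - w_ν(ε/c) ≲ ε²/σ. By convexity of K, the error of the projection at ν exceeds ε by at
most a multiple of such an increment of support functions (`norm_lse_sub_le_increment`), and
Gaussian concentration replaces the support functions by their means. Nonexpansiveness of the
projection carries the bound from packing points to all of K.

(c) If the loop continues at ε ≥ 2ε*, then ε ≲ R + σ (`le_worstCaseRate_of_threshold_le_Psi`). Here
T > ε²/(2σ), so some local width at distance at most 2ε exceeds another by ε²/(2σ). The variational
inequality for the projection limits this difference to a multiple of Rε/σ + ε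
(`localWidth_sub_le`).

Conclusion: by (a) min(σ, d) ≲ ε, so either σ ≲ ε in (b) or R ≤ d ≲ ε; hence R ≲ ε for every output.
Conversely the output is 2ε* ≲ R or twice a scale to which (c) applies, and if σ ≲ d then σ ≲ min(σ,
d) ≲ R absorbs σ. The loop ends because no scale ε ≥ c d satisfies its condition. The packing radius
δ matters only through 0 < δ ≤ ε. -/

/-- The standard Gaussian measure on `ℝⁿ`. -/
abbrev gauss (n : ℕ) : Measure (E n) := stdGaussian (E n)

/-! ### Exponential moments and shifts of the standard Gaussian. -/

/-- Fernique's theorem bounds a Gaussian exponential of the squared norm; completing the square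
dominates the linear exponent by it. -/
lemma integrable_exp_mul_norm (a : ℝ) : Integrable (fun x : E n => Real.exp (a * ‖x‖)) (gauss n) := by
  obtain ⟨C, hC, hint⟩ := IsGaussian.exists_integrable_exp_sq (gauss n)
  refine (hint.const_mul (Real.exp (a ^ 2 / (4 * C)))).mono' (by fun_prop) (ae_of_all _ fun x => ?_)
  rw [Real.norm_of_nonneg (Real.exp_pos _).le, ← Real.exp_add]
  apply Real.exp_le_exp.2
  have h : 0 ≤ C * (‖x‖ - a / (2 * C)) ^ 2 := by positivity
  have h2 : C * (‖x‖ - a / (2 * C)) ^ 2 = C * ‖x‖ ^ 2 - a * ‖x‖ + a ^ 2 / (4 * C) := by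
    field_simp
    ring
  linarith

/-- Measurable functions of at most exponential growth are Gaussian integrable. -/
lemma integrable_of_le_exp {f : E n → ℝ} (hf : AEStronglyMeasurable f (gauss n)) (a b : ℝ)
    (h : ∀ x, |f x| ≤ b * Real.exp (a * ‖x‖)) : Integrable f (gauss n) :=
  ((integrable_exp_mul_norm a).const_mul b).mono' hf (ae_of_all _ h)

lemma integrable_norm_gauss : Integrable (fun x : E n => ‖x‖) (gauss n) :=
  integrable_of_le_exp (by fun_prop) 1 1 fun x => by
    rw [abs_of_nonneg (norm_nonneg _), one_mul, one_mul]
    linarith [Real.add_one_le_exp ‖x‖]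

lemma integrable_inner_gauss (u : E n) : Integrable (fun x : E n => inner ℝ x u) (gauss n) :=
  (integrable_norm_gauss.mul_const ‖u‖).mono' (by fun_prop)
    (ae_of_all _ fun x => norm_inner_le_norm x u)

lemma integral_inner_gauss (u : E n) : ∫ x : E n, inner ℝ x u ∂(gauss n) = 0 := by
  simp_rw [real_inner_comm u]
  exact integral_strongDual_stdGaussian (innerSL ℝ u)

lemma integrable_exp_inner (u : E n) :
    Integrable (fun x : E n => Real.exp (inner ℝ u x)) (gauss n) :=
  integrable_of_le_exp (by fun_prop) ‖u‖ 1 fun x => by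
    rw [abs_of_pos (Real.exp_pos _), one_mul]
    exact Real.exp_le_exp.2 (real_inner_le_norm u x)

lemma integral_exp_inner (u : E n) :
    ∫ x : E n, Real.exp (inner ℝ u x) ∂(gauss n) = Real.exp (‖u‖ ^ 2 / 2) := by
  have h1 := IsGaussian.map_eq_gaussianReal (μ := gauss n) (innerSL ℝ u)
  have h2 := mgf_gaussianReal h1 1
  rw [integral_strongDual_stdGaussian, variance_dual_stdGaussian, innerSL_apply_norm] at h2
  simp only [mgf, one_mul, innerSL_apply_apply, one_pow, mul_one, zero_add] at h2
  rw [h2, Real.coe_toNNReal _ (by positivity)]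

/-- **Cameron–Martin**: an exponentially tilted standard Gaussian is a shifted one. -/
lemma tilted_gauss (h : E n) :
    (gauss n).tilted (fun x => inner ℝ h x) = (gauss n).map (fun x => x + h) := by
  have hp : IsProbabilityMeasure ((gauss n).tilted (fun x => inner ℝ h x)) :=
    isProbabilityMeasure_tilted (integrable_exp_inner h)
  have hq : IsProbabilityMeasure ((gauss n).map (fun x => x + h)) :=
    Measure.isProbabilityMeasure_map (by fun_prop)
  refine Measure.ext_of_charFun (funext fun t => ?_)
  -- Moment generating functions that agree on the whole real line continue analytically to agreeing
  -- complex ones; the value at `Complex.I` is the characteristic function at `t`.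
  have key : mgf (fun x => inner ℝ t x) ((gauss n).tilted (fun x => inner ℝ h x)) =
      mgf (fun x => inner ℝ t x) ((gauss n).map (fun x => x + h)) := by
    funext r
    simp only [mgf]
    rw [integral_exp_tilted (fun x => inner ℝ h x) (fun x => r * inner ℝ t x),
      integral_map (by fun_prop) (by fun_prop)]
    have e1 : ∀ x : E n, Real.exp (((fun x => inner ℝ h x) + fun x => r * inner ℝ t x) x) =
        Real.exp (inner ℝ (h + r • t) x) := fun x => by
      simp [inner_add_left, real_inner_smul_left]
    have e2 : ∀ x : E n, Real.exp (r * inner ℝ t (x + h)) =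
        Real.exp (r * inner ℝ t h) * Real.exp (inner ℝ (r • t) x) := fun x => by
      rw [← Real.exp_add, inner_add_right, real_inner_smul_left]
      ring_nf
    simp_rw [e1, e2]
    rw [integral_const_mul, integral_exp_inner, integral_exp_inner, integral_exp_inner,
      ← Real.exp_sub, ← Real.exp_add]
    congr 1
    rw [norm_add_sq_real, real_inner_smul_right, norm_smul, real_inner_comm]
    ring
  have hset : integrableExpSet (fun x => inner ℝ t x)
      ((gauss n).tilted (fun x => inner ℝ h x)) = Set.univ := by
    refine Set.eq_univ_of_forall fun r => ?_
    rw [integrableExpSet_eq_of_mgf key]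
    simp only [integrableExpSet, Set.mem_ofPred_eq]
    rw [integrable_map_measure (by fun_prop) (by fun_prop)]
    have : ((fun x : E n => Real.exp (r * inner ℝ t x)) ∘ fun x => x + h) = fun x =>
        Real.exp (r * inner ℝ t h) * Real.exp (inner ℝ (r • t) x) := by
      funext x
      simp only [Function.comp]
      rw [← Real.exp_add, inner_add_right, real_inner_smul_left]
      ring_nf
    rw [this]
    exact (integrable_exp_inner _).const_mul _
  have := eqOn_complexMGF_of_mgf key (x := Complex.I) (by simp [hset])
  simp only [complexMGF] at this
  rw [charFun_apply, charFun_apply]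
  simp_rw [real_inner_comm t, mul_comm _ Complex.I]
  exact this

/-- Comparison of the probabilities of an event under two Gaussian shifts. -/
lemma gauss_shift_le (h : E n) {A : Set (E n)} (hA : MeasurableSet A) {τ : ℝ} (hτ : 0 < τ) :
    (gauss n).real {x | x + h ∈ A} ≤
      τ * (gauss n).real A + Real.exp (‖h‖ ^ 2) / (4 * τ) := by
  have h1 : (gauss n).real {x | x + h ∈ A} = ∫ x in A, Real.exp (inner ℝ h x - ‖h‖ ^ 2 / 2) ∂(gauss n) := by
    have : (gauss n).real {x | x + h ∈ A} = ((gauss n).map (fun x => x + h)).real A := by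
      rw [map_measureReal_apply (by fun_prop) hA]; rfl
    rw [this, ← tilted_gauss, measureReal_def, tilted_apply_eq_ofReal_integral' _ hA,
      ENNReal.toReal_ofReal (integral_nonneg fun x => by positivity), integral_exp_inner]
    simp_rw [Real.exp_sub]
  have hi : Integrable (fun x : E n => Real.exp (inner ℝ ((2 : ℝ) • h) x)) (gauss n) :=
    integrable_exp_inner _
  have hi1 : Integrable (fun x : E n => Real.exp (inner ℝ h x - ‖h‖ ^ 2 / 2)) (gauss n) := by
    simp_rw [Real.exp_sub]
    exact (integrable_exp_inner h).div_const _
  -- The likelihood ratio `a` satisfies `a ≤ τ + a ^ 2 / (4 * τ)`, and its second moment is `exp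
  -- (‖h‖ ^ 2)`.
  have hpt : ∀ x : E n, Real.exp (inner ℝ h x - ‖h‖ ^ 2 / 2) ≤
      τ + Real.exp (inner ℝ ((2 : ℝ) • h) x) * (Real.exp (-‖h‖ ^ 2) / (4 * τ)) := fun x => by
    set a := Real.exp (inner ℝ h x - ‖h‖ ^ 2 / 2) with ha
    have e : Real.exp (inner ℝ ((2 : ℝ) • h) x) * (Real.exp (-‖h‖ ^ 2) / (4 * τ)) =
        a ^ 2 / (4 * τ) := by
      rw [mul_div_assoc', ← Real.exp_add, ha, ← Real.exp_nat_mul, real_inner_smul_left]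
      congr 2
      push_cast
      ring
    rw [e, ← sub_nonneg]
    have : τ + a ^ 2 / (4 * τ) - a = (2 * τ - a) ^ 2 / (4 * τ) := by
      field_simp; ring
    rw [this]; positivity
  rw [h1]
  calc ∫ x in A, Real.exp (inner ℝ h x - ‖h‖ ^ 2 / 2) ∂(gauss n)
      ≤ ∫ x in A, (τ + Real.exp (inner ℝ ((2 : ℝ) • h) x) * (Real.exp (-‖h‖ ^ 2) / (4 * τ)))
          ∂(gauss n) :=
        integral_mono hi1.integrableOn
          ((integrable_const τ).add (hi.mul_const _)).integrableOn hpt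
    _ = τ * (gauss n).real A +
        ∫ x in A, Real.exp (inner ℝ ((2 : ℝ) • h) x) * (Real.exp (-‖h‖ ^ 2) / (4 * τ)) ∂(gauss n) := by
        rw [integral_add (integrable_const τ).integrableOn (hi.mul_const _).integrableOn,
          setIntegral_const, smul_eq_mul, mul_comm]
    _ ≤ τ * (gauss n).real A +
        ∫ x, Real.exp (inner ℝ ((2 : ℝ) • h) x) * (Real.exp (-‖h‖ ^ 2) / (4 * τ)) ∂(gauss n) := by
        gcongr
        · exact ae_of_all _ fun x => by positivity
        · exact hi.mul_const _
        · exact Measure.restrict_le_self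
    _ = _ := by
        rw [integral_mul_const, integral_exp_inner, mul_div_assoc', ← Real.exp_add, norm_smul]
        congr 3
        norm_num
        ring

/-! ### Gaussian concentration for convex Lipschitz functions. -/

/-- `F` is convex and `s`-Lipschitz, expressed through measurable approximate subgradients of norm
at most `s`. -/
def HasApproxSubgradients (F : E n → ℝ) (s : ℝ) : Prop :=
  ∀ κ : ℝ, 0 < κ → ∃ p : E n → E n, Measurable p ∧ (∀ x, ‖p x‖ ≤ s) ∧
    ∀ a b, F a - F b ≤ inner ℝ (p a) (a - b) + κ

namespace HasApproxSubgradients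

variable {F : E n → ℝ} {s : ℝ}

lemma nonneg (hF : HasApproxSubgradients F s) : 0 ≤ s := by
  obtain ⟨p, -, hp, -⟩ := hF 1 one_pos
  exact (norm_nonneg _).trans (hp 0)

lemma abs_sub_le (hF : HasApproxSubgradients F s) (a b : E n) : |F a - F b| ≤ s * ‖a - b‖ := by
  have key : ∀ a b : E n, F a - F b ≤ s * ‖a - b‖ := fun a b => by
    refine le_of_forall_pos_le_add fun κ hκ => ?_
    obtain ⟨p, -, hp, hsub⟩ := hF κ hκ
    have h1 := hsub a b
    have h2 := real_inner_le_norm (p a) (a - b)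
    have h3 := mul_le_mul_of_nonneg_right (hp a) (norm_nonneg (a - b))
    linarith
  refine abs_sub_le_iff.2 ⟨key a b, ?_⟩
  rw [norm_sub_rev]
  exact key b a

lemma continuous (hF : HasApproxSubgradients F s) : Continuous F := by
  refine (LipschitzWith.of_dist_le_mul (K := s.toNNReal) fun a b => ?_).continuous
  rw [Real.dist_eq, dist_eq_norm, Real.coe_toNNReal _ hF.nonneg]
  exact hF.abs_sub_le a b

lemma abs_le (hF : HasApproxSubgradients F s) (x : E n) : |F x| ≤ |F 0| + s * ‖x‖ := by
  have h1 := hF.abs_sub_le x 0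
  rw [sub_zero] at h1
  have h2 := abs_add_le (F x - F 0) (F 0)
  rw [sub_add_cancel] at h2
  linarith

lemma integrable (hF : HasApproxSubgradients F s) : Integrable F (gauss n) :=
  ((integrable_const |F 0|).add (integrable_norm_gauss.const_mul s)).mono'
    hF.continuous.aestronglyMeasurable (ae_of_all _ hF.abs_le)

lemma integrable_exp (hF : HasApproxSubgradients F s) (l : ℝ) :
    Integrable (fun x => Real.exp (l * F x)) (gauss n) := by
  have := hF.continuous
  refine integrable_of_le_exp (by fun_prop) (|l| * s) (Real.exp (|l| * |F 0|)) fun x => ?_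
  rw [abs_of_pos (Real.exp_pos _), ← Real.exp_add]
  apply Real.exp_le_exp.2
  have h1 := mul_le_mul_of_nonneg_left (hF.abs_le x) (abs_nonneg l)
  have h2 := le_abs_self (l * F x)
  rw [abs_mul] at h2
  linarith

/-- The path of rotations from `z.1` to `z.2` by a quarter turn is cut into `N` equal arcs. The
increment of `F` telescopes along it, and Jensen's inequality for the exponential averages the arcs.
Finite arcs replace the derivative along the path, so `F` need not be differentiable. -/
lemma exp_sub_le_average {N : ℕ} (hN : 0 < N) (l : ℝ) (F : E n → ℝ) (z : E n × E n) :
    Real.exp (l * (F z.1 - F z.2)) ≤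
      ∑ i ∈ Finset.range N, (N : ℝ)⁻¹ *
        Real.exp (N * l * (F (ContinuousLinearMap.rotation (i * (Real.pi / (2 * N))) z).1 -
          F (Real.cos (Real.pi / (2 * N)) •
              (ContinuousLinearMap.rotation (i * (Real.pi / (2 * N))) z).1 +
            Real.sin (Real.pi / (2 * N)) •
              (ContinuousLinearMap.rotation (i * (Real.pi / (2 * N))) z).2))) := by
  set η := Real.pi / (2 * N) with hη
  have hN' : (N : ℝ) ≠ 0 := by positivity
  let u : ℕ → ℝ := fun i => F (Real.cos (i * η) • z.1 + Real.sin (i * η) • z.2)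
  have hu : ∀ i : ℕ, F (ContinuousLinearMap.rotation (i * η) z).1 -
      F (Real.cos η • (ContinuousLinearMap.rotation (i * η) z).1 +
        Real.sin η • (ContinuousLinearMap.rotation (i * η) z).2) = u i - u (i + 1) := fun i => by
    simp only [ContinuousLinearMap.rotation_apply, u]
    congr 2
    push_cast
    rw [add_mul, one_mul, Real.cos_add, Real.sin_add]
    module
  simp_rw [hu]
  have htel : F z.1 - F z.2 = ∑ i ∈ Finset.range N, (u i - u (i + 1)) := by
    rw [Finset.sum_range_sub']
    have : (N : ℝ) * η = Real.pi / 2 := by rw [hη]; field_simp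
    simp [u, this]
  have hJ := convexOn_exp.map_sum_le (t := Finset.range N) (w := fun _ => (N : ℝ)⁻¹)
    (p := fun i => N * l * (u i - u (i + 1))) (fun _ _ => by positivity)
    (by simp [hN']) (fun _ _ => Set.mem_univ _)
  simp only [smul_eq_mul] at hJ
  refine le_trans (le_of_eq ?_) hJ
  rw [htel, Finset.mul_sum]
  congr 1
  refine Finset.sum_congr rfl fun i _ => ?_
  field_simp

/-- The product Gaussian is rotation invariant, so all `N` arcs contribute the same integral. -/
lemma lintegral_exp_sub_le_step (hF : Continuous F) {N : ℕ} (hN : 0 < N) (l : ℝ) :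
    ∫⁻ z, ENNReal.ofReal (Real.exp (l * (F z.1 - F z.2))) ∂((gauss n).prod (gauss n)) ≤
      ∫⁻ z, ENNReal.ofReal (Real.exp (N * l * (F z.1 - F (Real.cos (Real.pi / (2 * N)) • z.1 +
        Real.sin (Real.pi / (2 * N)) • z.2)))) ∂((gauss n).prod (gauss n)) := by
  set G : E n × E n → ℝ≥0∞ := fun z => ENNReal.ofReal (Real.exp (N * l *
    (F z.1 - F (Real.cos (Real.pi / (2 * N)) • z.1 + Real.sin (Real.pi / (2 * N)) • z.2)))) with hG
  have hGm : Measurable G := by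
    have : Continuous fun z : E n × E n => Real.exp (N * l *
      (F z.1 - F (Real.cos (Real.pi / (2 * N)) • z.1 + Real.sin (Real.pi / (2 * N)) • z.2))) := by
      fun_prop
    exact this.measurable.ennreal_ofReal
  have hinv : ∀ θ : ℝ, ∫⁻ z, G (ContinuousLinearMap.rotation θ z) ∂((gauss n).prod (gauss n)) =
      ∫⁻ z, G z ∂((gauss n).prod (gauss n)) := fun θ => by
    have h0 : (gauss n)[id] = 0 := integral_id_stdGaussian
    conv_rhs => rw [← IsGaussian.map_rotation_eq_self h0 θ]
    rw [lintegral_map hGm (ContinuousLinearMap.continuous _).measurable]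
  calc _ ≤ ∫⁻ z, ∑ i ∈ Finset.range N, ENNReal.ofReal (N : ℝ)⁻¹ *
        G (ContinuousLinearMap.rotation (i * (Real.pi / (2 * N))) z)
          ∂((gauss n).prod (gauss n)) := by
        refine lintegral_mono fun z => ?_
        refine (ENNReal.ofReal_le_ofReal (exp_sub_le_average hN l F z)).trans (le_of_eq ?_)
        rw [ENNReal.ofReal_sum_of_nonneg fun i _ => by positivity]
        refine Finset.sum_congr rfl fun i _ => ?_
        rw [ENNReal.ofReal_mul (by positivity)]
    _ = _ := by
        have hm : ∀ θ : ℝ, Measurable fun z => G (ContinuousLinearMap.rotation θ z) := fun θ =>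
          hGm.comp (ContinuousLinearMap.continuous _).measurable
        rw [lintegral_finsetSum _ fun i _ => (hm _).const_mul _]
        simp_rw [lintegral_const_mul _ (hm _), hinv]
        rw [Finset.sum_const, Finset.card_range, nsmul_eq_mul, ← mul_assoc,
          ENNReal.ofReal_inv_of_pos (by positivity), ENNReal.ofReal_natCast,
          ENNReal.mul_inv_cancel (by simp [hN.ne']) (by simp), one_mul]

/-- The subgradient at the starting point depends on `z.1` only. Given `z.1`, the main term is
linear in the independent variable `z.2` and integrates exactly; the second-order drift `1 - cos η`
leaves only the factor in `‖x‖`. -/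
lemma lintegral_exp_step_le (hF : HasApproxSubgradients F s) {L η κ : ℝ} (hL : 0 ≤ L) (hκ : 0 < κ)
    (hη : 0 ≤ η) :
    ∫⁻ z, ENNReal.ofReal (Real.exp (L * (F z.1 - F (Real.cos η • z.1 + Real.sin η • z.2))))
        ∂((gauss n).prod (gauss n)) ≤
      ENNReal.ofReal (Real.exp (L * κ + (L * η * s) ^ 2 / 2)) *
        ∫⁻ x, ENNReal.ofReal (Real.exp (L * (η ^ 2 / 2) * s * ‖x‖)) ∂(gauss n) := by
  obtain ⟨p, hpm, hps, hsub⟩ := hF κ hκ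
  have hs := hF.nonneg
  have hpt : ∀ z : E n × E n, L * (F z.1 - F (Real.cos η • z.1 + Real.sin η • z.2)) ≤
      L * κ + L * (η ^ 2 / 2) * s * ‖z.1‖ + inner ℝ (-(L * Real.sin η) • p z.1) z.2 := fun z => by
    have h1 := hsub z.1 (Real.cos η • z.1 + Real.sin η • z.2)
    have h2 : z.1 - (Real.cos η • z.1 + Real.sin η • z.2) =
        (1 - Real.cos η) • z.1 - Real.sin η • z.2 := by module
    rw [h2, inner_sub_right, real_inner_smul_right, real_inner_smul_right] at h1
    have h3 : (1 - Real.cos η) * inner ℝ (p z.1) z.1 ≤ (η ^ 2 / 2) * (s * ‖z.1‖) := by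
      have h4 := Real.one_sub_sq_div_two_le_cos (x := η)
      have h5 : inner ℝ (p z.1) z.1 ≤ s * ‖z.1‖ :=
        (real_inner_le_norm _ _).trans (mul_le_mul_of_nonneg_right (hps _) (norm_nonneg _))
      have h6 := Real.cos_le_one η
      calc _ ≤ (1 - Real.cos η) * (s * ‖z.1‖) := mul_le_mul_of_nonneg_left h5 (by linarith)
        _ ≤ _ := mul_le_mul_of_nonneg_right (by linarith) (by positivity)
    rw [real_inner_smul_left]
    have := mul_le_mul_of_nonneg_left (h1.trans (by linarith :
      _ ≤ (η ^ 2 / 2) * (s * ‖z.1‖) - Real.sin η * inner ℝ (p z.1) z.2 + κ)) hL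
    linarith
  have hinner : ∀ x : E n, ∫⁻ y, ENNReal.ofReal (Real.exp (inner ℝ (-(L * Real.sin η) • p x) y))
      ∂(gauss n) ≤ ENNReal.ofReal (Real.exp ((L * η * s) ^ 2 / 2)) := fun x => by
    rw [← ofReal_integral_eq_lintegral_ofReal (integrable_exp_inner _)
      (ae_of_all _ fun y => (Real.exp_pos _).le), integral_exp_inner]
    refine ENNReal.ofReal_le_ofReal (Real.exp_le_exp.2 ?_)
    gcongr
    rw [norm_smul, norm_neg, norm_mul, Real.norm_of_nonneg hL]
    have h7 : ‖Real.sin η‖ ≤ η := by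
      have := Real.abs_sin_le_abs (x := η)
      rwa [abs_of_nonneg hη] at this
    gcongr
    exact hps x
  calc _ ≤ ∫⁻ z : E n × E n, ENNReal.ofReal (Real.exp (L * κ)) *
        (ENNReal.ofReal (Real.exp (L * (η ^ 2 / 2) * s * ‖z.1‖)) *
          ENNReal.ofReal (Real.exp (inner ℝ (-(L * Real.sin η) • p z.1) z.2)))
            ∂((gauss n).prod (gauss n)) := by
        refine lintegral_mono fun z => ?_
        rw [← ENNReal.ofReal_mul (Real.exp_pos _).le, ← ENNReal.ofReal_mul (Real.exp_pos _).le,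
          ← Real.exp_add, ← Real.exp_add, ← add_assoc]
        exact ENNReal.ofReal_le_ofReal (Real.exp_le_exp.2 (hpt z))
    _ = ENNReal.ofReal (Real.exp (L * κ)) * ∫⁻ x,
        (ENNReal.ofReal (Real.exp (L * (η ^ 2 / 2) * s * ‖x‖)) *
          ∫⁻ y, ENNReal.ofReal (Real.exp (inner ℝ (-(L * Real.sin η) • p x) y)) ∂(gauss n))
            ∂(gauss n) := by
        rw [lintegral_const_mul _ (by fun_prop), lintegral_prod _ (by fun_prop)]
        congr 1
        refine lintegral_congr fun x => ?_
        dsimp only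
        rw [lintegral_const_mul _ (by fun_prop)]
    _ ≤ ENNReal.ofReal (Real.exp (L * κ)) * ∫⁻ x,
        (ENNReal.ofReal (Real.exp (L * (η ^ 2 / 2) * s * ‖x‖)) *
          ENNReal.ofReal (Real.exp ((L * η * s) ^ 2 / 2))) ∂(gauss n) := by
        gcongr with x
        exact hinner x
    _ = _ := by
        rw [lintegral_mul_const _ (by fun_prop), Real.exp_add, ENNReal.ofReal_mul (Real.exp_pos _).le]
        ring

/-- Symmetrised Gaussian concentration (Maurey–Pisier). -/
lemma integral_exp_sub_le (hF : HasApproxSubgradients F s) {l : ℝ} (hl : 0 ≤ l) :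
    ∫ z, Real.exp (l * (F z.1 - F z.2)) ∂((gauss n).prod (gauss n)) ≤
      Real.exp (Real.pi ^ 2 * l ^ 2 * s ^ 2 / 8) := by
  have hs := hF.nonneg
  have hFc := hF.continuous
  set c : ℝ := Real.pi ^ 2 * l * s / 8 with hc
  have hc0 : 0 ≤ c := by positivity
  set B : ℝ := ∫ x : E n, Real.exp (c * ‖x‖) ∂(gauss n) with hB
  have hB1 : 0 ≤ B := integral_nonneg fun x => (Real.exp_pos _).le
  -- With `κ = 1 / N ^ 2` the subgradient error costs `exp (l / N)`. The drift costs the mean of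
  -- `exp (c / N * ‖x‖)`, which convexity bounds by `1 + B / N`. Both factors tend to one, while the
  -- main exponent does not depend on `N`.
  have key : ∀ N : ℕ, 0 < N → ∫ z, Real.exp (l * (F z.1 - F z.2)) ∂((gauss n).prod (gauss n)) ≤
      Real.exp (l / N) * Real.exp (Real.pi ^ 2 * l ^ 2 * s ^ 2 / 8) * (1 + B / N) := by
    intro N hN
    have hN' : (0 : ℝ) < N := by exact_mod_cast hN
    have hN1 : (1 : ℝ) ≤ N := by exact_mod_cast hN
    have h1 := lintegral_exp_sub_le_step hFc hN l
    have h2 := h1.trans (hF.lintegral_exp_step_le (L := N * l) (η := Real.pi / (2 * N))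
      (κ := 1 / N ^ 2) (by positivity) (by positivity) (by positivity))
    have e1 : N * l * (1 / (N : ℝ) ^ 2) + (N * l * (Real.pi / (2 * N)) * s) ^ 2 / 2 =
        l / N + Real.pi ^ 2 * l ^ 2 * s ^ 2 / 8 := by field_simp; ring
    have e2 : N * l * ((Real.pi / (2 * N)) ^ 2 / 2) * s = c / N := by
      rw [hc]; field_simp; ring
    rw [e1, e2, ← ofReal_integral_eq_lintegral_ofReal (integrable_exp_mul_norm _)
      (ae_of_all _ fun y => (Real.exp_pos _).le), ← ENNReal.ofReal_mul (Real.exp_pos _).le] at h2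
    rw [integral_eq_lintegral_of_nonneg_ae (ae_of_all _ fun y => (Real.exp_pos _).le)
      (by fun_prop)]
    have h3 := ENNReal.toReal_le_of_le_ofReal
      (mul_nonneg (Real.exp_pos _).le (integral_nonneg fun x => (Real.exp_pos _).le)) h2
    refine h3.trans ?_
    rw [Real.exp_add]
    gcongr
    calc ∫ x : E n, Real.exp (c / N * ‖x‖) ∂(gauss n)
        ≤ ∫ x : E n, (1 + Real.exp (c * ‖x‖) / N) ∂(gauss n) := by
          refine integral_mono (integrable_exp_mul_norm _)
            ((integrable_const 1).add ((integrable_exp_mul_norm c).div_const _)) fun x => ?_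
          have hcv : Real.exp ((1 - 1 / (N : ℝ)) • 0 + (1 / (N : ℝ)) • (c * ‖x‖)) ≤
              (1 - 1 / (N : ℝ)) • Real.exp 0 + (1 / (N : ℝ)) • Real.exp (c * ‖x‖) :=
            convexOn_exp.2 (Set.mem_univ _) (Set.mem_univ _)
              (by rw [sub_nonneg, div_le_one hN']; exact hN1) (by positivity) (by ring)
          simp only [smul_eq_mul, mul_zero, zero_add, Real.exp_zero, mul_one] at hcv
          have : (1 : ℝ) / N * (c * ‖x‖) = c / N * ‖x‖ := by ring
          rw [this] at hcv
          have h5 : 0 ≤ 1 / (N : ℝ) := by positivity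
          simp only
          rw [div_eq_mul_one_div (Real.exp _) (N : ℝ)]
          linarith
      _ = 1 + B / N := by
          rw [integral_add (integrable_const 1) ((integrable_exp_mul_norm c).div_const _),
            integral_div]
          simp [hB]
  have hlim : Filter.Tendsto (fun N : ℕ => Real.exp (l / N) *
      Real.exp (Real.pi ^ 2 * l ^ 2 * s ^ 2 / 8) * (1 + B / N)) Filter.atTop
      (nhds (Real.exp 0 * Real.exp (Real.pi ^ 2 * l ^ 2 * s ^ 2 / 8) * (1 + 0))) := by
    refine Filter.Tendsto.mul (Filter.Tendsto.mul_const _ ?_) ?_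
    · exact (Real.continuous_exp.tendsto 0).comp (tendsto_const_div_atTop_nhds_zero_nat l)
    · exact (tendsto_const_div_atTop_nhds_zero_nat B).const_add 1
  rw [Real.exp_zero, one_mul, add_zero, mul_one] at hlim
  exact ge_of_tendsto hlim (Filter.eventually_atTop.2 ⟨1, fun N hN => key N hN⟩)

/-- **Gaussian concentration** for convex Lipschitz functions. -/
theorem integral_exp_le (hF : HasApproxSubgradients F s) (l : ℝ) :
    ∫ x, Real.exp (l * (F x - ∫ y, F y ∂(gauss n))) ∂(gauss n) ≤
      Real.exp (Real.pi ^ 2 * l ^ 2 * s ^ 2 / 8) := by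
  have hFc := hF.continuous
  have hprod : ∀ l : ℝ, ∫ z, Real.exp (l * (F z.1 - F z.2)) ∂((gauss n).prod (gauss n)) =
      (∫ x, Real.exp (l * F x) ∂(gauss n)) * ∫ x, Real.exp (-l * F x) ∂(gauss n) := fun l => by
    rw [← integral_prod_mul (fun x => Real.exp (l * F x)) (fun x => Real.exp (-l * F x))]
    refine integral_congr_ae (ae_of_all _ fun z => ?_)
    simp only
    rw [← Real.exp_add]
    ring_nf
  have hsym : (∫ x, Real.exp (l * F x) ∂(gauss n)) * ∫ x, Real.exp (-l * F x) ∂(gauss n) ≤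
      Real.exp (Real.pi ^ 2 * l ^ 2 * s ^ 2 / 8) := by
    rcases le_total 0 l with hl | hl
    · rw [← hprod]
      exact hF.integral_exp_sub_le hl
    · have := hF.integral_exp_sub_le (neg_nonneg.2 hl)
      rw [hprod, neg_neg, neg_sq, mul_comm] at this
      exact this
  -- Jensen's inequality for the second factor replaces the independent copy of `F` by its mean.
  have hJ := convexOn_exp.map_integral_le (μ := gauss n) (f := fun x => -l * F x)
    Real.continuous_exp.continuousOn isClosed_univ (ae_of_all _ fun _ => Set.mem_univ _)
    (hF.integrable.const_mul _) (hF.integrable_exp _)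
  rw [integral_const_mul] at hJ
  have e : ∀ x, Real.exp (l * (F x - ∫ y, F y ∂(gauss n))) =
      Real.exp (l * F x) * Real.exp (-l * ∫ y, F y ∂(gauss n)) := fun x => by
    rw [← Real.exp_add]; ring_nf
  simp_rw [e]
  rw [integral_mul_const]
  exact (mul_le_mul_of_nonneg_left hJ (integral_nonneg fun x => (Real.exp_pos _).le)).trans hsym

lemma integrable_sub_sq (hF : HasApproxSubgradients F s) (m : ℝ) :
    Integrable (fun x => (F x - m) ^ 2) (gauss n) := by
  have hFc := hF.continuous
  have h1 := (hF.integrable_exp 1).const_mul (Real.exp (-m))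
  have h2 := (hF.integrable_exp (-1)).const_mul (Real.exp m)
  refine ((h1.add h2).const_mul 2).mono' (by fun_prop) (ae_of_all _ fun x => ?_)
  simp only [Pi.add_apply]
  rw [← Real.exp_add, ← Real.exp_add, Real.norm_of_nonneg (sq_nonneg _)]
  have h3 := Real.quadratic_le_exp_of_nonneg (abs_nonneg (F x - m))
  have h4 : Real.exp |F x - m| ≤ Real.exp (F x - m) + Real.exp (-(F x - m)) :=
    Real.exp_abs_le _
  rw [sq_abs] at h3
  have h5 := abs_nonneg (F x - m)
  have e1 : -m + 1 * F x = F x - m := by ring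
  have e2 : m + -1 * F x = -(F x - m) := by ring
  rw [e1, e2]
  linarith

/-- A Poincaré type bound for the variance. -/
theorem integral_sub_sq_le (hF : HasApproxSubgradients F s) :
    ∫ x, (F x - ∫ y, F y ∂(gauss n)) ^ 2 ∂(gauss n) ≤ 16 * s ^ 2 := by
  set m := ∫ y, F y ∂(gauss n) with hm
  -- The case `s = 0` is allowed, so the normalisation is by some `t > s`, with `t` tending to `s`
  -- at the end.
  have key : ∀ t : ℝ, s < t → ∫ x, (F x - m) ^ 2 ∂(gauss n) ≤ 16 * t ^ 2 := by
    intro t hst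
    have ht : 0 < t := hF.nonneg.trans_lt hst
    have hI : ∀ l : ℝ, Integrable (fun x => Real.exp (l * (F x - m))) (gauss n) := fun l => by
      have : (fun x => Real.exp (l * (F x - m))) =
          fun x => Real.exp (l * F x) * Real.exp (-(l * m)) := by
        funext x
        rw [← Real.exp_add]; ring_nf
      rw [this]
      exact (hF.integrable_exp l).mul_const _
    -- The exponent is at most π²/8 ≤ 1.25, and exp 1.25 ≤ 4. With u² ≤ 2(exp u + exp(-u)) this
    -- gives 2 · (4 + 4) = 16.
    have hb : ∀ l : ℝ, l ^ 2 = 1 / t ^ 2 → ∫ x, Real.exp (l * (F x - m)) ∂(gauss n) ≤ 4 := by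
      intro l hl
      refine (hF.integral_exp_le l).trans ?_
      rw [hl]
      have h1 : Real.pi ^ 2 * (1 / t ^ 2) * s ^ 2 / 8 ≤ 1.25 := by
        have h2 : s ^ 2 / t ^ 2 ≤ 1 := by
          rw [div_le_one (by positivity)]
          exact pow_le_pow_left₀ hF.nonneg hst.le 2
        have h3 : Real.pi ^ 2 ≤ 10 := by nlinarith [Real.pi_lt_d2, Real.pi_pos]
        have h4 : 0 ≤ s ^ 2 / t ^ 2 := by positivity
        have h5 : Real.pi ^ 2 * (1 / t ^ 2) * s ^ 2 / 8 = Real.pi ^ 2 * (s ^ 2 / t ^ 2) / 8 := by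
          ring
        rw [h5]
        nlinarith
      refine (Real.exp_le_exp.2 h1).trans ?_
      have h6 : Real.exp 1.25 ^ 4 ≤ 4 ^ 4 := by
        rw [← Real.exp_nat_mul]
        have : ((4 : ℕ) : ℝ) * 1.25 = ((5 : ℕ) : ℝ) * 1 := by norm_num
        rw [this, Real.exp_nat_mul]
        have h7 := Real.exp_one_lt_d9
        calc Real.exp 1 ^ 5 ≤ 2.7182818286 ^ 5 := by gcongr
          _ ≤ 4 ^ 4 := by norm_num
      exact le_of_pow_le_pow_left₀ (by norm_num) (by norm_num) h6
    have hpt : ∀ x, (F x - m) ^ 2 ≤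
        2 * t ^ 2 * (Real.exp (1 / t * (F x - m)) + Real.exp (-(1 / t) * (F x - m))) := fun x => by
      set u := 1 / t * (F x - m) with hu
      have e1 : F x - m = t * u := by rw [hu]; field_simp
      rw [neg_mul, ← hu, e1, mul_pow, mul_comm 2, mul_assoc]
      gcongr
      have h3 := Real.quadratic_le_exp_of_nonneg (abs_nonneg u)
      rw [sq_abs] at h3
      have h4 := Real.exp_abs_le u
      linarith [abs_nonneg u]
    have h5 := integral_mono (hF.integrable_sub_sq m) (((hI (1 / t)).add (hI (-(1 / t)))).const_mul _) hpt
    simp only [Pi.add_apply] at h5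
    rw [integral_const_mul, integral_add (hI _) (hI _)] at h5
    have h6 := hb (1 / t) (by rw [div_pow, one_pow])
    have h7 := hb (-(1 / t)) (by rw [neg_sq, div_pow, one_pow])
    nlinarith [sq_nonneg t]
  have hlim : Filter.Tendsto (fun t : ℝ => 16 * t ^ 2) (nhdsWithin s (Set.Ioi s))
      (nhds (16 * s ^ 2)) :=
    (((continuous_pow 2).const_mul 16).tendsto s).mono_left nhdsWithin_le_nhds
  exact ge_of_tendsto hlim (by filter_upwards [self_mem_nhdsWithin] with t ht using key t ht)

/-- The expected maximum of finitely many subgaussian functions. -/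
theorem integral_le_of_le_max {ι : Type*} (J : Finset ι) (hJ : J.Nonempty) (G : ι → E n → ℝ)
    (hG : ∀ j ∈ J, HasApproxSubgradients (G j) s) {m : ℝ}
    (hm : ∀ j ∈ J, ∫ x, G j x ∂(gauss n) ≤ m) {H : E n → ℝ} (hH : Integrable H (gauss n))
    (hHG : ∀ x, ∃ j ∈ J, H x ≤ G j x) {l : ℝ} (hl : 0 < l) :
    ∫ x, H x ∂(gauss n) ≤ m + Real.log J.card / l + Real.pi ^ 2 * l * s ^ 2 / 8 := by
  have hc : (0 : ℝ) < J.card := by exact_mod_cast hJ.card_pos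
  have hI : ∀ j ∈ J, Integrable (fun x => Real.exp (l * (G j x - m))) (gauss n) := fun j hj => by
    have : (fun x => Real.exp (l * (G j x - m))) =
        fun x => Real.exp (l * G j x) * Real.exp (-(l * m)) := by
      funext x
      rw [← Real.exp_add]; ring_nf
    rw [this]
    exact ((hG j hj).integrable_exp l).mul_const _
  -- The exponential of a maximum is at most the sum of the exponentials; `l` stays free so that it
  -- can be tuned to the noise level.
  have hpt : ∀ x, Real.exp (l * (H x - m)) ≤ ∑ j ∈ J, Real.exp (l * (G j x - m)) := fun x => by
    obtain ⟨j, hj, hle⟩ := hHG x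
    refine le_trans ?_ (Finset.single_le_sum (f := fun j => Real.exp (l * (G j x - m)))
      (fun j _ => (Real.exp_pos _).le) hj)
    exact Real.exp_le_exp.2 (by gcongr)
  have hIH : Integrable (fun x => Real.exp (l * (H x - m))) (gauss n) := by
    refine (integrable_finsetSum J hI).mono' ?_ (ae_of_all _ fun x => ?_)
    · exact Real.continuous_exp.comp_aestronglyMeasurable
        ((hH.aestronglyMeasurable.sub aestronglyMeasurable_const).const_mul l)
    · rw [Real.norm_of_nonneg (Real.exp_pos _).le]
      exact hpt x
  have h1 := convexOn_exp.map_integral_le (μ := gauss n) (f := fun x => l * (H x - m))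
    Real.continuous_exp.continuousOn isClosed_univ (ae_of_all _ fun _ => Set.mem_univ _)
    ((hH.sub (integrable_const m)).const_mul l) hIH
  have h2 : ∫ x, Real.exp (l * (H x - m)) ∂(gauss n) ≤
      J.card * Real.exp (Real.pi ^ 2 * l ^ 2 * s ^ 2 / 8) := by
    refine (integral_mono hIH (integrable_finsetSum J hI) hpt).trans ?_
    rw [integral_finsetSum J hI, ← nsmul_eq_mul]
    refine Finset.sum_le_card_nsmul _ _ _ fun j hj => ?_
    refine le_trans ?_ ((hG j hj).integral_exp_le l)
    have hI' : Integrable (fun x => Real.exp (l * (G j x - ∫ y, G j y ∂(gauss n)))) (gauss n) := by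
      have : (fun x => Real.exp (l * (G j x - ∫ y, G j y ∂(gauss n)))) =
          fun x => Real.exp (l * G j x) * Real.exp (-(l * ∫ y, G j y ∂(gauss n))) := by
        funext x
        rw [← Real.exp_add]; ring_nf
      rw [this]
      exact ((hG j hj).integrable_exp l).mul_const _
    refine integral_mono (hI j hj) hI' fun x => Real.exp_le_exp.2 ?_
    have := hm j hj
    gcongr
  have h3 := h1.trans h2
  rw [← Real.exp_log hc, ← Real.exp_add, Real.exp_le_exp, integral_const_mul,
    integral_sub hH (integrable_const m), integral_const, probReal_univ, one_smul] at h3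
  have h4 : ∫ x, H x ∂(gauss n) - m ≤
      (Real.log J.card + Real.pi ^ 2 * l ^ 2 * s ^ 2 / 8) / l := by
    rw [le_div_iff₀ hl]; linarith
  have h5 : (Real.log J.card + Real.pi ^ 2 * l ^ 2 * s ^ 2 / 8) / l =
      Real.log J.card / l + Real.pi ^ 2 * l * s ^ 2 / 8 := by field_simp
  linarith

end HasApproxSubgradients

/-! ### The metric projection onto a compact convex set. -/

section LeastSquares

variable {K : Set (E n)}

lemma lse_spec (hK : IsCompact K) (hne : K.Nonempty) (y : E n) :
    lse K y ∈ K ∧ ∀ ν ∈ K, ‖y - lse K y‖ ^ 2 ≤ ‖y - ν‖ ^ 2 := by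
  have : ∃ v, v ∈ K ∧ ∀ ν ∈ K, ‖y - v‖ ^ 2 ≤ ‖y - ν‖ ^ 2 := by
    obtain ⟨v, hv, hmin⟩ := hK.exists_isMinOn hne (f := fun v => ‖y - v‖ ^ 2) (by fun_prop)
    exact ⟨v, hv, fun ν hν => hmin hν⟩
  exact Classical.epsilon_spec this

lemma lse_mem (hK : IsCompact K) (hne : K.Nonempty) (y : E n) : lse K y ∈ K :=
  (lse_spec hK hne y).1

/-- The variational inequality for the projection. -/
lemma lse_inner_le (hK : IsCompact K) (hc : Convex ℝ K) (hne : K.Nonempty) (y : E n) {t : E n}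
    (ht : t ∈ K) : inner ℝ (y - lse K y) (t - lse K y) ≤ 0 := by
  obtain ⟨hm, hmin⟩ := lse_spec hK hne y
  refine (norm_eq_iInf_iff_real_inner_le_zero hc hm).1 ?_ t ht
  have : Nonempty K := ⟨⟨_, hm⟩⟩
  refine le_antisymm (le_ciInf fun w => ?_) (ciInf_le ⟨0, ?_⟩ (⟨_, hm⟩ : K))
  · exact le_of_pow_le_pow_left₀ two_ne_zero (norm_nonneg _) (hmin w w.2)
  · rintro _ ⟨w, rfl⟩
    exact norm_nonneg _

/-- The variational inequalities at `y` and `z`, each tested with the other projection, add up to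
`‖p - q‖ ^ 2 ≤ ⟪y - z, p - q⟫`. -/
lemma norm_lse_sub_le (hK : IsCompact K) (hc : Convex ℝ K) (hne : K.Nonempty) (y z : E n) :
    ‖lse K y - lse K z‖ ≤ ‖y - z‖ := by
  have h1 := lse_inner_le hK hc hne y (lse_mem hK hne z)
  have h2 := lse_inner_le hK hc hne z (lse_mem hK hne y)
  set p := lse K y
  set q := lse K z
  have h3 : ‖p - q‖ ^ 2 ≤ inner ℝ (y - z) (p - q) := by
    rw [← real_inner_self_eq_norm_sq]
    have e1 : inner ℝ (y - p) (q - p) = - inner ℝ (y - p) (p - q) := by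
      rw [← inner_neg_right, neg_sub]
    have e2 : inner ℝ (y - z) (p - q) - inner ℝ (p - q) (p - q) =
        inner ℝ (y - p) (p - q) - inner ℝ (z - q) (p - q) := by
      rw [← inner_sub_left, ← inner_sub_left]
      congr 1
      abel
    linarith
  have h4 := h3.trans (real_inner_le_norm _ _)
  by_contra! h
  have h5 : 0 ≤ ‖y - z‖ := norm_nonneg _
  nlinarith

lemma continuous_lse (hK : IsCompact K) (hc : Convex ℝ K) (hne : K.Nonempty) :
    Continuous (lse K) := by
  refine (LipschitzWith.of_dist_le_mul (K := 1) fun a b => ?_).continuous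
  rw [dist_eq_norm, dist_eq_norm, NNReal.coe_one, one_mul]
  exact norm_lse_sub_le hK hc hne a b

end LeastSquares

/-! ### Support functions and Gaussian widths. -/

section SupportFunction

variable {T : Set (E n)}

/-- The support function of `T - v`. -/
def centeredSupport (T : Set (E n)) (v x : E n) : ℝ :=
  (⨆ t : T, inner ℝ x (t : E n)) - inner ℝ x v

lemma bddAbove_inner (hT : IsCompact T) (x : E n) :
    BddAbove (Set.range fun t : T => inner ℝ x (t : E n)) := by
  have := (hT.image (f := fun t => inner ℝ x t) (by fun_prop)).bddAbove
  rwa [Set.image_eq_range] at this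

lemma inner_sub_le_centeredSupport (hT : IsCompact T) (v x : E n) {t : E n} (ht : t ∈ T) :
    inner ℝ x (t - v) ≤ centeredSupport T v x := by
  rw [centeredSupport, inner_sub_right]
  exact sub_le_sub_right (le_ciSup (bddAbove_inner hT x) (⟨t, ht⟩ : T)) _

lemma centeredSupport_le (hne : T.Nonempty) {v x : E n} {a : ℝ}
    (h : ∀ t ∈ T, inner ℝ x (t - v) ≤ a) : centeredSupport T v x ≤ a := by
  have : Nonempty T := hne.to_subtype
  rw [centeredSupport, sub_le_iff_le_add]
  refine ciSup_le fun t => ?_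
  have := h t t.2
  rw [inner_sub_right] at this
  linarith

lemma exists_inner_sub_eq_centeredSupport (hT : IsCompact T) (hne : T.Nonempty) (v x : E n) :
    ∃ t ∈ T, centeredSupport T v x = inner ℝ x (t - v) := by
  obtain ⟨t, ht, hmax⟩ := hT.exists_isMaxOn hne (f := fun t => inner ℝ x (t - v)) (by fun_prop)
  exact ⟨t, ht, le_antisymm (centeredSupport_le hne fun u hu => hmax hu)
    (inner_sub_le_centeredSupport hT v x ht)⟩

/-- A maximiser of `inner ℝ x` over `T` would be an exact subgradient, but it needs a measurable
selection. Projecting `v + a⁻¹ • x` onto `T` maximises the same functional with the penalty `a / 2 *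
‖t - v‖ ^ 2`; this point is unique, continuous in `x`, and optimal up to `a * r ^ 2 ≤ κ`. -/
lemma hasApproxSubgradients_centeredSupport (hT : IsCompact T) (hc : Convex ℝ T)
    (hne : T.Nonempty) {v : E n} {r : ℝ} (hr : T ⊆ Metric.closedBall v r) :
    HasApproxSubgradients (centeredSupport T v) r := by
  intro κ hκ
  set a := κ / (r ^ 2 + 1) with ha
  have ha0 : 0 < a := by positivity
  have har : a * r ^ 2 ≤ κ := by
    rw [ha, div_mul_eq_mul_div, div_le_iff₀ (by positivity)]
    nlinarith
  refine ⟨fun x => lse T (v + a⁻¹ • x) - v, ?_, fun x => ?_, fun x y => ?_⟩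
  · have := continuous_lse hT hc hne
    exact Continuous.measurable (by fun_prop)
  · have := hr (lse_mem hT hne (v + a⁻¹ • x))
    rwa [Metric.mem_closedBall, dist_eq_norm] at this
  · set q := lse T (v + a⁻¹ • x) with hq
    have hqm : q ∈ T := lse_mem hT hne _
    have h1 := inner_sub_le_centeredSupport hT v y hqm
    have h2 : centeredSupport T v x ≤ inner ℝ x (q - v) + κ := by
      refine centeredSupport_le hne fun t ht => ?_
      have h3 := lse_inner_le hT hc hne (v + a⁻¹ • x) ht
      rw [← hq] at h3
      have hu := hr ht
      rw [Metric.mem_closedBall, dist_eq_norm] at hu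
      have e1 : v + a⁻¹ • x - q = a⁻¹ • x - (q - v) := by abel
      have e2 : t - q = (t - v) - (q - v) := by abel
      rw [e1, e2] at h3
      set m := q - v
      set u := t - v
      rw [inner_sub_left, real_inner_smul_left, inner_sub_right m, real_inner_self_eq_norm_sq] at h3
      have h4 := real_inner_le_norm m u
      have h5 : inner ℝ x (u - m) ≤ a * (inner ℝ m u - ‖m‖ ^ 2) := by
        have : a * (a⁻¹ * inner ℝ x (u - m)) = inner ℝ x (u - m) := by field_simp
        rw [← this]
        gcongr
        linarith
      have h6 : inner ℝ m u - ‖m‖ ^ 2 ≤ r ^ 2 := by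
        have h7 : ‖u‖ ^ 2 ≤ r ^ 2 := pow_le_pow_left₀ (norm_nonneg _) hu 2
        nlinarith [sq_nonneg (‖m‖ - ‖u‖), sq_nonneg ‖m‖]
      have h8 := mul_le_mul_of_nonneg_left h6 ha0.le
      rw [inner_sub_right] at h5
      linarith
    rw [inner_sub_right, real_inner_comm x, real_inner_comm y]
    linarith

/-- Recentring subtracts a linear form of mean zero. Widths at different points can therefore be
compared through support functions with a common centre, whose Lipschitz constants stay of the order
of the scale. -/
lemma integral_centeredSupport (hT : IsCompact T) (hc : Convex ℝ T) (hne : T.Nonempty) (v : E n) :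
    ∫ x, centeredSupport T v x ∂(gauss n) = gaussianWidth T := by
  obtain ⟨r, hr⟩ := hT.isBounded.subset_closedBall v
  have h1 := (hasApproxSubgradients_centeredSupport hT hc hne hr).integrable
  have h2 : gaussianWidth T = ∫ x, (centeredSupport T v x + inner ℝ x v) ∂(gauss n) := by
    simp [gaussianWidth, centeredSupport]
  rw [h2, integral_add h1 (integrable_inner_gauss v), integral_inner_gauss, add_zero]

lemma gaussianWidth_mono {T' : Set (E n)} (hT : IsCompact T) (hc : Convex ℝ T) (hne : T.Nonempty)
    (hT' : IsCompact T') (hc' : Convex ℝ T') (h : T ⊆ T') :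
    gaussianWidth T ≤ gaussianWidth T' := by
  have hne' := hne.mono h
  obtain ⟨r, hr⟩ := hT'.isBounded.subset_closedBall 0
  rw [← integral_centeredSupport hT hc hne 0, ← integral_centeredSupport hT' hc' hne' 0]
  exact integral_mono (hasApproxSubgradients_centeredSupport hT hc hne (h.trans hr)).integrable
    (hasApproxSubgradients_centeredSupport hT' hc' hne' hr).integrable
    fun x => centeredSupport_le hne fun t ht => inner_sub_le_centeredSupport hT' 0 x (h ht)

end SupportFunction

/-! ### Local sets and bounds for their widths. -/

section Localization

variable {K : Set (E n)}

lemma isCompact_local (hK : IsCompact K) (μ : E n) (r : ℝ) :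
    IsCompact (Metric.closedBall μ r ∩ K) := hK.inter_left Metric.isClosed_closedBall

lemma convex_local (hc : Convex ℝ K) (μ : E n) (r : ℝ) :
    Convex ℝ (Metric.closedBall μ r ∩ K) := (convex_closedBall μ r).inter hc

lemma nonempty_local {μ : E n} (hμ : μ ∈ K) {r : ℝ} (hr : 0 ≤ r) :
    (Metric.closedBall μ r ∩ K).Nonempty := ⟨μ, Metric.mem_closedBall_self hr, hμ⟩

lemma bddAbove_localWidth (hK : IsCompact K) (hc : Convex ℝ K) {r : ℝ} (hr : 0 ≤ r) :
    BddAbove (Set.range fun η : K => localWidth K η r) := by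
  refine ⟨gaussianWidth K, ?_⟩
  rintro _ ⟨η, rfl⟩
  exact gaussianWidth_mono (isCompact_local hK _ r) (convex_local hc _ r) (nonempty_local η.2 hr)
    hK hc Set.inter_subset_right

end Localization

/-! ### Elementary bounds for the risk. -/

section Risk

variable {K : Set (E n)} {σ : ℝ}

lemma norm_lse_sub_le_diam (hK : IsCompact K) {μ : E n} (hμ : μ ∈ K) (y : E n) :
    ‖lse K y - μ‖ ≤ Metric.diam K := by
  rw [← dist_eq_norm]
  exact Metric.dist_le_diam_of_mem hK.isBounded (lse_mem hK ⟨μ, hμ⟩ y) hμ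

lemma continuous_lse_shift (hK : IsCompact K) (hc : Convex ℝ K) (hne : K.Nonempty) (μ : E n) :
    Continuous fun x : E n => ‖lse K (μ + σ • x) - μ‖ := by
  have := continuous_lse hK hc hne
  fun_prop

lemma integrable_lse_sq (hK : IsCompact K) (hc : Convex ℝ K) {μ : E n} (hμ : μ ∈ K) :
    Integrable (fun x : E n => ‖lse K (μ + σ • x) - μ‖ ^ 2) (gauss n) := by
  refine (integrable_const (Metric.diam K ^ 2)).mono'
    ((continuous_lse_shift hK hc ⟨μ, hμ⟩ μ).pow 2).aestronglyMeasurable (ae_of_all _ fun x => ?_)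
  rw [Real.norm_of_nonneg (sq_nonneg _)]
  exact pow_le_pow_left₀ (norm_nonneg _) (norm_lse_sub_le_diam hK hμ _) 2

lemma risk_nonneg (μ : E n) : 0 ≤ risk K σ μ := integral_nonneg fun _ => sq_nonneg _

lemma risk_le_of_forall {μ : E n} {g : E n → ℝ} (hK : IsCompact K) (hc : Convex ℝ K) (hμ : μ ∈ K)
    (hg : Integrable g (gauss n)) (h : ∀ x, ‖lse K (μ + σ • x) - μ‖ ^ 2 ≤ g x) :
    risk K σ μ ≤ ∫ x, g x ∂(gauss n) :=
  integral_mono (integrable_lse_sq hK hc hμ) hg h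

lemma risk_le_diam_sq (hK : IsCompact K) (hc : Convex ℝ K) {μ : E n} (hμ : μ ∈ K) :
    risk K σ μ ≤ Metric.diam K ^ 2 := by
  have := risk_le_of_forall (σ := σ) hK hc hμ (integrable_const (Metric.diam K ^ 2)) fun x =>
    pow_le_pow_left₀ (norm_nonneg _) (norm_lse_sub_le_diam hK hμ _) 2
  simpa using this

lemma worstCaseRate_nonneg : 0 ≤ worstCaseRate K σ := Real.sqrt_nonneg _

lemma risk_le_worstCaseRate_sq (hK : IsCompact K) (hc : Convex ℝ K) {μ : E n} (hμ : μ ∈ K) :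
    risk K σ μ ≤ worstCaseRate K σ ^ 2 := by
  have hb : BddAbove (Set.range fun μ : K => risk K σ μ) := by
    refine ⟨Metric.diam K ^ 2, ?_⟩
    rintro _ ⟨η, rfl⟩
    exact risk_le_diam_sq hK hc η.2
  have h1 := le_ciSup hb (⟨μ, hμ⟩ : K)
  rw [worstCaseRate, Real.sq_sqrt ((risk_nonneg μ).trans h1)]
  exact h1

lemma worstCaseRate_le (hne : K.Nonempty) {b : ℝ} (hb : 0 ≤ b) (h : ∀ μ ∈ K, risk K σ μ ≤ b ^ 2) :
    worstCaseRate K σ ≤ b := by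
  have : Nonempty K := hne.to_subtype
  exact Real.sqrt_le_iff.2 ⟨hb, ciSup_le fun μ => h μ μ.2⟩

lemma worstCaseRate_le_diam (hK : IsCompact K) (hc : Convex ℝ K) (hne : K.Nonempty) :
    worstCaseRate K σ ≤ Metric.diam K :=
  worstCaseRate_le hne Metric.diam_nonneg fun _ hμ => risk_le_diam_sq hK hc hμ

end Risk

/-! ### Finite maximal packings. -/

section Packing

variable {K A : Set (E n)} {δ : ℝ}

lemma packingNumber_ne_top (hK : IsCompact K) (hδ : 0 < δ) (hA : A ⊆ K) :
    Metric.packingNumber δ.toNNReal A ≠ ⊤ := by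
  have hδ2 : (δ / 2).toNNReal ≠ 0 := by simpa using hδ
  obtain ⟨N, -, hfin, hcov⟩ := Metric.exists_finite_isCover_of_isCompact hδ2 hK
  have h1 := Metric.packingNumber_two_mul_le_externalCoveringNumber (δ / 2).toNNReal A
  have h2 := (hcov.anti hA).externalCoveringNumber_le_encard
  have e : 2 * (δ / 2).toNNReal = δ.toNNReal := by
    rw [← Real.toNNReal_ofNat, ← Real.toNNReal_mul (by norm_num)]
    congr 1
    ring
  rw [e] at h1
  exact ne_top_of_le_ne_top hfin.encard_lt_top.ne (h1.trans h2)

lemma exists_isMaximalPacking (hK : IsCompact K) (hδ : 0 < δ) (hA : A ⊆ K) :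
    ∃ P, IsMaximalPacking δ A P := by
  obtain ⟨C, hCA, hfin, hsep, hcard⟩ :=
    Metric.exists_set_encard_eq_packingNumber (packingNumber_ne_top hK hδ hA)
  refine ⟨hfin.toFinset, ?_, ?_, ?_⟩
  · simpa using hCA
  · simpa [ENNReal.ofReal] using hsep
  · rw [← hcard, hfin.encard_eq_coe_toFinset_card]

lemma lt_edist_iff (hδ : 0 ≤ δ) (x y : E n) : ENNReal.ofReal δ < edist x y ↔ δ < dist x y := by
  rw [edist_dist, ENNReal.ofReal_lt_ofReal_iff_of_nonneg hδ]

namespace IsMaximalPacking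

variable {P : Finset (E n)}

lemma lt_dist (h : IsMaximalPacking δ A P) (hδ : 0 ≤ δ) {x y : E n} (hx : x ∈ P) (hy : y ∈ P)
    (hxy : x ≠ y) : δ < dist x y :=
  (lt_edist_iff hδ x y).1 (h.2.1 hx hy hxy)

lemma card_le (h : IsMaximalPacking δ A P) {S : Finset (E n)} (hS : (S : Set (E n)) ⊆ A)
    (hsep : ∀ x ∈ S, ∀ y ∈ S, x ≠ y → δ < dist x y) : S.card ≤ P.card := by
  have h1 : Metric.IsSeparated (δ.toNNReal : ℝ≥0∞) (S : Set (E n)) := fun x hx y hy hxy => by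
    have := hsep x hx y hy hxy
    rcases le_total 0 δ with h0 | h0
    · exact (lt_edist_iff h0 x y).2 this
    · rw [Real.toNNReal_of_nonpos h0, ENNReal.coe_zero]
      exact edist_pos.2 hxy
  have h2 := h1.encard_le_packingNumber hS
  rw [← h.2.2, Set.encard_coe_eq_coe_finsetCard] at h2
  exact_mod_cast h2

/-- A point farther than `δ` from all of `P` could be added to `P`, contradicting maximal
cardinality. -/
lemma exists_dist_le (h : IsMaximalPacking δ A P) (hδ : 0 ≤ δ) {x : E n} (hx : x ∈ A) :
    ∃ y ∈ P, dist x y ≤ δ := by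
  classical
  by_contra! hcon
  have hxP : x ∉ P := fun hxP => by
    have := hcon x hxP
    rw [dist_self] at this
    linarith
  have := h.card_le (S := insert x P) (by
      rw [Finset.coe_insert]
      exact Set.insert_subset hx h.1) (by
      intro a ha b hb hab
      rcases Finset.mem_insert.1 ha with rfl | ha' <;> rcases Finset.mem_insert.1 hb with rfl | hb'
      · exact absurd rfl hab
      · exact hcon b hb'
      · rw [dist_comm]; exact hcon a ha'
      · exact h.lt_dist hδ ha' hb' hab)
  rw [Finset.card_insert_of_notMem hxP] at this
  omega

lemma nonempty (h : IsMaximalPacking δ A P) (hδ : 0 ≤ δ) (hA : A.Nonempty) : P.Nonempty := by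
  obtain ⟨x, hx⟩ := hA
  obtain ⟨y, hy, -⟩ := h.exists_dist_le hδ hx
  exact ⟨y, hy⟩

end IsMaximalPacking

end Packing

/-! ### Local entropy: finiteness, monotonicity, values near the diameter. -/

section LocalEntropy

variable {K : Set (E n)} {c ε : ℝ}

/-- The local packing number as a natural number. -/
abbrev localCount (c : ℝ) (K : Set (E n)) (ε : ℝ) : ℕ := (localPackingNumber c K ε).toNat

lemma localPackingNumber_ne_top (hK : IsCompact K) (hc : 0 < c) (hε : 0 < ε) :
    localPackingNumber c K ε ≠ ⊤ := by
  obtain ⟨P, hP⟩ := exists_isMaximalPacking hK (div_pos hε hc) (subset_refl K)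
  refine ne_top_of_le_ne_top (ENat.natCast_ne_top P.card) (iSup₂_le fun θ _ => ?_)
  obtain ⟨Q, hQ⟩ := exists_isMaximalPacking hK (div_pos hε hc)
    (Set.inter_subset_right (s := Metric.closedBall θ ε) (t := K))
  rw [← hQ.2.2]
  exact_mod_cast hP.card_le (hQ.1.trans Set.inter_subset_right)
    fun x hx y hy hxy => hQ.lt_dist (div_pos hε hc).le hx hy hxy

lemma card_le_localCount (hK : IsCompact K) (hc : 0 < c) (hε : 0 < ε) {θ : E n} (hθ : θ ∈ K)
    {S : Finset (E n)} (hS : (S : Set (E n)) ⊆ Metric.closedBall θ ε ∩ K)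
    (hsep : ∀ x ∈ S, ∀ y ∈ S, x ≠ y → ε / c < dist x y) : S.card ≤ localCount c K ε := by
  obtain ⟨Q, hQ⟩ := exists_isMaximalPacking hK (div_pos hε hc)
    (Set.inter_subset_right (s := Metric.closedBall θ ε) (t := K))
  have h1 : (Q.card : ℕ∞) ≤ localPackingNumber c K ε := by
    rw [hQ.2.2]
    exact le_iSup₂ (f := fun θ (_ : θ ∈ K) =>
      Metric.packingNumber (ε / c).toNNReal (Metric.closedBall θ ε ∩ K)) θ hθ
  rw [← ENat.natCast_toNat (localPackingNumber_ne_top hK hc hε)] at h1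
  exact (hQ.card_le hS hsep).trans (by exact_mod_cast h1)

lemma exists_localCount (hK : IsCompact K) (hne : K.Nonempty) (hc : 0 < c) (hε : 0 < ε) :
    ∃ θ ∈ K, ∃ S : Finset (E n), (S : Set (E n)) ⊆ Metric.closedBall θ ε ∩ K ∧
      (∀ x ∈ S, ∀ y ∈ S, x ≠ y → ε / c < dist x y) ∧ S.card = localCount c K ε := by
  have : Nonempty K := hne.to_subtype
  have htop := localPackingNumber_ne_top hK hc hε
  have e : localPackingNumber c K ε = ⨆ θ : K,
      Metric.packingNumber (ε / c).toNNReal (Metric.closedBall (θ : E n) ε ∩ K) := by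
    rw [localPackingNumber, iSup_subtype']
  obtain ⟨θ, hθ⟩ := ENat.exists_eq_iSup_of_lt_top (f := fun θ : K =>
      Metric.packingNumber (ε / c).toNNReal (Metric.closedBall (θ : E n) ε ∩ K))
      (by rw [← e]; exact htop.lt_top)
  obtain ⟨Q, hQ⟩ := exists_isMaximalPacking hK (div_pos hε hc)
    (Set.inter_subset_right (s := Metric.closedBall (θ : E n) ε) (t := K))
  refine ⟨θ, θ.2, Q, hQ.1, fun x hx y hy hxy => hQ.lt_dist (div_pos hε hc).le hx hy hxy, ?_⟩
  have h2 := hQ.2.2.trans (hθ.trans e.symm)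
  rw [localCount, ← h2, ENat.toNat_natCast]

lemma localCount_pos (hK : IsCompact K) (hne : K.Nonempty) (hc : 0 < c) (hε : 0 < ε) :
    0 < localCount c K ε := by
  obtain ⟨θ, hθ⟩ := hne
  have := card_le_localCount hK hc hε hθ (S := {θ}) (by simpa using ⟨hε.le, hθ⟩)
    (by simp +contextual)
  exact Nat.one_le_iff_ne_zero.1 (by simpa using this) |> Nat.pos_of_ne_zero

/-- The homothety about `θ` with ratio `ε' / ε` shrinks ball, packing and separation alike, and
convexity keeps the image of the packing in `K`. -/
lemma localCount_anti (hK : IsCompact K) (hconv : Convex ℝ K) (hne : K.Nonempty) (hc : 0 < c)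
    {ε' : ℝ} (hε' : 0 < ε') (h : ε' ≤ ε) : localCount c K ε ≤ localCount c K ε' := by
  have hε : 0 < ε := hε'.trans_le h
  obtain ⟨θ, hθ, S, hS, hsep, hcard⟩ := exists_localCount hK hne hc hε
  set a := ε' / ε with ha
  have ha0 : 0 < a := div_pos hε' hε
  have ha1 : a ≤ 1 := (div_le_one hε).2 h
  have haε : a * ε = ε' := by rw [ha]; field_simp
  classical
  have hdist : ∀ x y : E n, dist (AffineMap.homothety θ a x) (AffineMap.homothety θ a y) =
      a * dist x y := fun x y => by
    simp only [AffineMap.homothety_apply, vsub_eq_sub, vadd_eq_add, dist_eq_norm]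
    rw [add_sub_add_right_eq_sub, ← smul_sub, sub_sub_sub_cancel_right, norm_smul,
      Real.norm_of_nonneg ha0.le]
  have hinj : Function.Injective (AffineMap.homothety θ a) := fun x y hxy => by
    have := hdist x y
    rw [hxy, dist_self] at this
    exact dist_eq_zero.1 ((mul_eq_zero.1 this.symm).resolve_left ha0.ne')
  rw [← hcard, ← Finset.card_image_of_injective S hinj]
  refine card_le_localCount hK hc hε' hθ ?_ ?_
  · intro z hz
    rw [Finset.coe_image] at hz
    obtain ⟨x, hx, rfl⟩ := hz
    obtain ⟨hxb, hxK⟩ := hS hx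
    refine ⟨?_, ?_⟩
    · have := hdist x θ
      rw [AffineMap.homothety_apply_same] at this
      rw [Metric.mem_closedBall, this, ← haε]
      exact mul_le_mul_of_nonneg_left hxb ha0.le
    · rw [AffineMap.homothety_apply, vsub_eq_sub, vadd_eq_add, add_comm]
      exact hconv.add_smul_sub_mem hθ hxK ⟨ha0.le, ha1⟩
  · intro x hx y hy hxy
    obtain ⟨x, hx', rfl⟩ := Finset.mem_image.1 hx
    obtain ⟨y, hy', rfl⟩ := Finset.mem_image.1 hy
    rw [hdist, ← haε, mul_div_assoc]
    exact mul_lt_mul_of_pos_left (hsep x hx' y hy' fun h => hxy (h ▸ rfl)) ha0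

lemma localEntropy_nonneg (c : ℝ) (K : Set (E n)) (ε : ℝ) : 0 ≤ localEntropy c K ε :=
  Real.log_natCast_nonneg _

lemma localEntropy_anti (hK : IsCompact K) (hconv : Convex ℝ K) (hne : K.Nonempty) (hc : 0 < c)
    {ε' : ℝ} (hε' : 0 < ε') (h : ε' ≤ ε) : localEntropy c K ε ≤ localEntropy c K ε' := by
  have h1 := localCount_pos hK hne hc (hε'.trans_le h)
  have h2 := localCount_anti hK hconv hne hc hε' h
  exact Real.log_le_log (by exact_mod_cast h1) (by exact_mod_cast h2)

lemma localEntropy_eq_zero (hK : IsCompact K) (hne : K.Nonempty) (hc : 0 < c) (hε : 0 < ε)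
    (h : Metric.diam K ≤ ε / c) : localEntropy c K ε = 0 := by
  obtain ⟨θ, hθ, S, hS, hsep, hcard⟩ := exists_localCount hK hne hc hε
  have h1 : S.card ≤ 1 := Finset.card_le_one.2 fun x hx y hy => by
    by_contra hxy
    have h2 := hsep x hx y hy hxy
    have h3 := Metric.dist_le_diam_of_mem hK.isBounded (hS hx).2 (hS hy).2
    linarith
  rw [localEntropy, ← localCount, ← hcard]
  interval_cases S.card <;> simp

lemma exists_dist_eq (hK : IsCompact K) (hconv : Convex ℝ K) (hne : K.Nonempty)
    (hε : 0 < ε) (h : ε ≤ Metric.diam K) : ∃ θ ∈ K, ∃ p ∈ K, dist p θ = ε := by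
  have hmax : ∃ θ ∈ K, ∃ t ∈ K, ε ≤ dist t θ := by
    obtain ⟨z, hz, hmax⟩ := (hK.prod hK).exists_isMaxOn (hne.prod hne)
      (f := fun z : E n × E n => dist z.1 z.2) (by fun_prop)
    rw [isMaxOn_iff] at hmax
    exact ⟨z.2, hz.2, z.1, hz.1, h.trans (Metric.diam_le_of_forall_dist_le dist_nonneg
      fun x hx y hy => hmax (x, y) (Set.mk_mem_prod hx hy))⟩
  obtain ⟨θ, hθ, t, ht, hd⟩ := hmax
  have hpos : 0 < dist t θ := by linarith
  have ha0 : 0 < ε / dist t θ := div_pos hε hpos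
  have ha1 : ε / dist t θ ≤ 1 := (div_le_one hpos).2 hd
  refine ⟨θ, hθ, θ + (ε / dist t θ) • (t - θ), hconv.add_smul_sub_mem hθ ht ⟨ha0.le, ha1⟩, ?_⟩
  rw [dist_eq_norm (θ + _), add_sub_cancel_left, norm_smul, Real.norm_of_nonneg ha0.le,
    ← dist_eq_norm t θ, div_mul_cancel₀ _ hpos.ne']

/-- Convexity supplies two points of `K` at distance exactly `ε`, which exceeds `ε / c`. -/
lemma two_le_localCount (hK : IsCompact K) (hconv : Convex ℝ K) (hne : K.Nonempty) (hc : 1 < c)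
    (hε : 0 < ε) (h : ε ≤ Metric.diam K) : 2 ≤ localCount c K ε := by
  have hc0 : 0 < c := by linarith
  obtain ⟨θ, hθ, p, hpK, hdist⟩ := exists_dist_eq hK hconv hne hε h
  have hlt : ε / c < ε := div_lt_self hε hc
  have hne' : p ≠ θ := fun h => by rw [h, dist_self] at hdist; linarith
  classical
  have hS : (({p, θ} : Finset (E n)) : Set (E n)) ⊆ Metric.closedBall θ ε ∩ K := by
    intro z hz
    simp only [Finset.coe_insert, Finset.coe_singleton, Set.mem_insert_iff,
      Set.mem_singleton_iff] at hz
    rcases hz with rfl | rfl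
    · exact ⟨hdist.le, hpK⟩
    · exact ⟨Metric.mem_closedBall_self hε.le, hθ⟩
  have hsep : ∀ x ∈ ({p, θ} : Finset (E n)), ∀ y ∈ ({p, θ} : Finset (E n)), x ≠ y →
      ε / c < dist x y := by
    intro x hx y hy hxy
    simp only [Finset.mem_insert, Finset.mem_singleton] at hx hy
    rcases hx with rfl | rfl <;> rcases hy with rfl | rfl
    · exact absurd rfl hxy
    · rwa [hdist]
    · rwa [dist_comm, hdist]
    · exact absurd rfl hxy
  have := card_le_localCount hK hc0 hε hθ hS hsep
  rwa [Finset.card_pair hne'] at this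

end LocalEntropy

/-! ### A lower bound for the risk from packings. -/

section MinimaxLowerBound

variable {K : Set (E n)} {σ : ℝ}

/-- A Fano type lower bound for the worst case risk of the least squares estimator. -/
theorem le_worstCaseRate_of_packing (hK : IsCompact K) (hc : Convex ℝ K) (hσ : 0 < σ) {θ : E n}
    {ε r : ℝ} (hr : 0 < r) {S : Finset (E n)}
    (hS : (S : Set (E n)) ⊆ Metric.closedBall θ ε ∩ K)
    (hsep : ∀ x ∈ S, ∀ y ∈ S, x ≠ y → r < dist x y) (hcard : 2 ≤ S.card)
    (hε : ε ^ 2 / σ ^ 2 ≤ Real.log S.card / 2) : r / 8 ≤ worstCaseRate K σ := by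
  by_contra! hlt
  have hSne : S.Nonempty := Finset.card_pos.1 (by omega)
  have hne : K.Nonempty := by
    obtain ⟨p, hp⟩ := hSne
    exact ⟨p, (hS hp).2⟩
  -- The events that the estimator lands near `p` are disjoint, so under the reference mean `θ` one
  -- of them has probability at most `1 / S.card`. Shifting the mean to that `p` raises it only
  -- moderately.
  let B : E n → Set (E n) := fun p => {x | ‖lse K (θ + σ • x) - p‖ < r / 2}
  have hcont := continuous_lse hK hc hne
  have hBm : ∀ p, MeasurableSet (B p) := fun p =>
    (isOpen_lt (by fun_prop) continuous_const).measurableSet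
  have hdisj : (S : Set (E n)).PairwiseDisjoint B := by
    intro p hp q hq hpq
    refine Set.disjoint_left.2 fun x hx hx' => ?_
    have h1 := hsep p hp q hq hpq
    have h2 := dist_triangle_left p q (lse K (θ + σ • x))
    have h3 : dist (lse K (θ + σ • x)) p < r / 2 := by rw [dist_eq_norm]; exact hx
    have h4 : dist (lse K (θ + σ • x)) q < r / 2 := by rw [dist_eq_norm]; exact hx'
    linarith
  have hM : (2 : ℝ) ≤ S.card := by exact_mod_cast hcard
  have hsum : ∑ p ∈ S, (gauss n).real (B p) ≤ ∑ p ∈ S, (1 / (S.card : ℝ)) := by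
    rw [← measureReal_biUnion_finset hdisj (fun p _ => hBm p), Finset.sum_const, nsmul_eq_mul,
      mul_one_div_cancel (by positivity)]
    exact measureReal_le_one
  obtain ⟨p, hp, hBp⟩ := Finset.exists_le_of_sum_le hSne hsum
  obtain ⟨hpb, hpK⟩ := hS hp
  set h : E n := σ⁻¹ • (p - θ) with hh
  have hset : {x | x + h ∈ B p} = {x | ‖lse K (p + σ • x) - p‖ < r / 2} := by
    ext x
    simp only [B, Set.mem_ofPred_eq, hh]
    have : θ + σ • (x + σ⁻¹ • (p - θ)) = p + σ • x := by
      rw [smul_add, smul_smul, mul_inv_cancel₀ hσ.ne', one_smul]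
      abel
    rw [this]
  have hM0 : (0 : ℝ) < S.card := by linarith
  set u := Real.sqrt S.card with hu
  have hu2 : u ^ 2 = S.card := Real.sq_sqrt hM0.le
  have hu0 : 0 < u := Real.sqrt_pos.2 hM0
  have hu1 : 4 / 3 < u := by nlinarith
  have hexp : Real.exp (‖h‖ ^ 2) ≤ u := by
    have h1 : ‖h‖ ^ 2 ≤ ε ^ 2 / σ ^ 2 := by
      rw [hh, norm_smul, norm_inv, Real.norm_of_nonneg hσ.le, mul_pow, inv_pow,
        inv_mul_eq_div]
      gcongr
      rw [← dist_eq_norm]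
      exact hpb
    rw [hu, ← Real.exp_log (Real.sqrt_pos.2 hM0), Real.log_sqrt hM0.le]
    exact Real.exp_le_exp.2 (h1.trans hε)
  -- With `u = √S.card` and `τ = u / 2` the two terms are at most `1 / (2 * u) < 3 / 8` and `1 / 2`.
  -- The estimator thus misses `p` by `r / 2` with probability above 1/8, whereas Markov's
  -- inequality and a rate below `r / 8` allow only 1/16.
  have h1 := gauss_shift_le h (hBm p) (τ := u / 2) (by positivity)
  have h2 : u / 2 * (gauss n).real (B p) + Real.exp (‖h‖ ^ 2) / (4 * (u / 2)) ≤
      1 / (2 * u) + 1 / 2 := by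
    have h3 : u / 2 * (gauss n).real (B p) ≤ 1 / (2 * u) := by
      calc _ ≤ u / 2 * (1 / S.card) := by gcongr
        _ = 1 / (2 * u) := by rw [← hu2]; field_simp
    have h4 : Real.exp (‖h‖ ^ 2) / (4 * (u / 2)) ≤ 1 / 2 := by
      rw [div_le_iff₀ (by positivity)]
      linarith
    linarith
  have h5 : 1 / (2 * u) < 3 / 8 := by
    rw [div_lt_div_iff₀ (by positivity) (by norm_num)]
    linarith
  rw [hset] at h1
  have hmk := mul_meas_ge_le_integral_of_nonneg (μ := gauss n)
    (f := fun x => ‖lse K (p + σ • x) - p‖ ^ 2) (ae_of_all _ fun x => sq_nonneg _)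
    (integrable_lse_sq hK hc hpK) ((r / 2) ^ 2)
  have hrisk : ∫ x, ‖lse K (p + σ • x) - p‖ ^ 2 ∂(gauss n) ≤ worstCaseRate K σ ^ 2 :=
    risk_le_worstCaseRate_sq hK hc hpK
  have hR : worstCaseRate K σ ^ 2 ≤ (r / 8) ^ 2 :=
    pow_le_pow_left₀ worstCaseRate_nonneg hlt.le 2
  have hcompl : {x : E n | (r / 2) ^ 2 ≤ ‖lse K (p + σ • x) - p‖ ^ 2} =
      {x | ‖lse K (p + σ • x) - p‖ < r / 2}ᶜ := by
    ext x
    simp only [Set.mem_ofPred_eq, Set.mem_compl_iff, not_lt]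
    exact pow_le_pow_iff_left₀ (by positivity) (norm_nonneg _) two_ne_zero
  have hm : MeasurableSet {x : E n | ‖lse K (p + σ • x) - p‖ < r / 2} :=
    (isOpen_lt (by fun_prop) continuous_const).measurableSet
  rw [hcompl, probReal_compl_eq_one_sub hm] at hmk
  have h6 : (r / 2) ^ 2 * (1 - (gauss n).real {x | ‖lse K (p + σ • x) - p‖ < r / 2}) ≤
      (r / 2) ^ 2 * (1 / 16) := by
    refine (hmk.trans hrisk).trans (hR.trans (le_of_eq ?_))
    ring
  have h7 := le_of_mul_le_mul_left h6 (by positivity)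
  linarith

end MinimaxLowerBound

/-! ### The lower rate lies between min(σ, d) and the worst case rate. -/

section LowerRate

variable {K : Set (E n)} {σ c L : ℝ}

lemma constC_pos (hc : 0 < c) : 0 < constC c := by
  rw [constC]; positivity

lemma le_of_mem_lowerRate_set (hK : IsCompact K) (hne : K.Nonempty) (hc : 0 < c)
    (hσ : 0 < σ) {ε : ℝ} (hε : 0 < ε)
    (h : constC c ^ 2 * ε ^ 2 / (4 * σ ^ 2) ≤ (L / c) ^ 2 * localEntropy c K ε) :
    ε ≤ c * Metric.diam K := by
  by_contra! hlt
  rw [localEntropy_eq_zero hK hne hc hε (by rw [le_div_iff₀ hc]; linarith), mul_zero] at h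
  have := constC_pos hc
  have : 0 < constC c ^ 2 * ε ^ 2 / (4 * σ ^ 2) := by positivity
  linarith

lemma le_lowerRate (hK : IsCompact K) (hne : K.Nonempty) (hc : 0 < c)
    (hσ : 0 < σ) {ε : ℝ} (hε : 0 < ε)
    (h : constC c ^ 2 * ε ^ 2 / (4 * σ ^ 2) ≤ (L / c) ^ 2 * localEntropy c K ε) :
    ε ≤ lowerRate c L K σ :=
  le_csSup ⟨c * Metric.diam K, fun _ hx => le_of_mem_lowerRate_set hK hne hc hσ hx.1 hx.2⟩ ⟨hε, h⟩

/-- The local entropy is small above the lower rate. -/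
lemma localEntropy_lt_of_lowerRate_lt (hK : IsCompact K) (hne : K.Nonempty) (hc : 0 < c)
    (hσ : 0 < σ) {ε : ℝ} (hε : 0 < ε) (h : lowerRate c L K σ < ε) :
    (L / c) ^ 2 * localEntropy c K ε < constC c ^ 2 * ε ^ 2 / (4 * σ ^ 2) := by
  by_contra! hle
  exact absurd (le_lowerRate hK hne hc hσ hε hle) (not_le.2 h)

lemma diam_pos (hK : IsCompact K) (hnt : K.Nontrivial) : 0 < Metric.diam K := by
  obtain ⟨x, hx, y, hy, hxy⟩ := hnt
  exact (dist_pos.2 hxy).trans_le (Metric.dist_le_diam_of_mem hK.isBounded hx hy)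

lemma min_le_lowerRate (hK : IsCompact K) (hconv : Convex ℝ K) (hnt : K.Nontrivial) (hc : 1 < c)
    (hL : 0 < L) (hσ : 0 < σ) :
    L / (c * constC c + L) * min σ (Metric.diam K) ≤ lowerRate c L K σ := by
  have hc0 : 0 < c := by linarith
  have hC := constC_pos hc0
  have hd := diam_pos hK hnt
  have hmin : 0 < min σ (Metric.diam K) := lt_min hσ hd
  -- Chosen so that `κ ≤ 1` and `constC c * κ ≤ L / c`. Up to the diameter the entropy is at least
  -- log 2 > 1/4, which is all the defining inequality then needs.
  set κ := L / (c * constC c + L) with hκ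
  have hκ0 : 0 < κ := by positivity
  have hκ1 : κ ≤ 1 := by
    rw [hκ, div_le_one (by positivity)]
    have : 0 < c * constC c := by positivity
    linarith
  have hκC : constC c * κ ≤ L / c := by
    rw [hκ, mul_div_assoc', div_le_div_iff₀ (by positivity) hc0]
    nlinarith
  have hε : 0 < κ * min σ (Metric.diam K) := by positivity
  refine le_lowerRate hK hnt.nonempty hc0 hσ hε ?_
  have h2 := two_le_localCount hK hconv hnt.nonempty hc hε
    ((mul_le_of_le_one_left hmin.le hκ1).trans (min_le_right _ _))
  have hlog : 1 / 4 ≤ localEntropy c K (κ * min σ (Metric.diam K)) := by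
    have h3 : Real.log 2 ≤ localEntropy c K (κ * min σ (Metric.diam K)) :=
      Real.log_le_log (by norm_num) (by exact_mod_cast h2)
    have := Real.log_two_gt_d9
    linarith
  have h4 : (constC c * (κ * min σ (Metric.diam K))) ^ 2 ≤ (L / c * σ) ^ 2 := by
    refine pow_le_pow_left₀ (by positivity) ?_ 2
    rw [← mul_assoc]
    exact mul_le_mul hκC (min_le_left _ _) hmin.le (by positivity)
  calc _ ≤ (L / c) ^ 2 * (1 / 4) := by
        rw [div_le_iff₀ (by positivity), ← mul_pow]
        linarith
    _ ≤ _ := by gcongr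

lemma lowerRate_pos (hK : IsCompact K) (hconv : Convex ℝ K) (hnt : K.Nontrivial) (hc : 1 < c)
    (hL : 0 < L) (hσ : 0 < σ) : 0 < lowerRate c L K σ := by
  have hc0 : 0 < c := by linarith
  have hC := constC_pos hc0
  have hd := diam_pos hK hnt
  have : 0 < min σ (Metric.diam K) := lt_min hσ hd
  refine lt_of_lt_of_le ?_ (min_le_lowerRate hK hconv hnt hc hL hσ)
  positivity

/-- The lower rate is a lower bound for the worst case rate. -/
lemma lowerRate_le_worstCaseRate (hK : IsCompact K) (hconv : Convex ℝ K) (hnt : K.Nontrivial)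
    (hc : 1 < c) (hL : 0 < L) (hσ : 0 < σ) :
    lowerRate c L K σ ≤ 8 * (c * constC c + 3 * L) / constC c * worstCaseRate K σ := by
  have hc0 : 0 < c := by linarith
  have hC := constC_pos hc0
  -- Shrinking `ε` by `κ` does not lower the entropy, and it turns the defining inequality into `(κ
  -- * ε) ^ 2 / σ ^ 2 ≤ 4 / 9` times the entropy, below the factor 1/2 required by the packing
  -- bound.
  set κ := c * constC c / (c * constC c + 3 * L) with hκ
  have hcC : 0 < c * constC c := by positivity
  have hκ0 : 0 < κ := by positivity
  have hκ1 : κ ≤ 1 := by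
    rw [hκ, div_le_one (by positivity)]
    linarith
  have hκL : κ * (3 * L) ≤ c * constC c := by
    rw [hκ, div_mul_eq_mul_div, div_le_iff₀ (by positivity)]
    nlinarith
  have hlr := lowerRate_pos hK hconv hnt hc hL hσ
  -- The supremum of the empty set is 0 by convention, so positivity of the lower rate shows that
  -- the set is nonempty.
  refine csSup_le (by
    by_contra hemp
    rw [Set.not_nonempty_iff_eq_empty] at hemp
    rw [lowerRate, hemp, Real.sSup_empty] at hlr
    exact lt_irrefl _ hlr) ?_
  rintro ε ⟨hε, hent⟩
  have hκε : 0 < κ * ε := by positivity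
  have hmono := localEntropy_anti hK hconv hnt.nonempty hc0 hκε (mul_le_of_le_one_left hε.le hκ1)
  obtain ⟨θ, hθ, S, hS, hsep, hcard⟩ := exists_localCount hK hnt.nonempty hc0 hκε
  have hSe : Real.log S.card = localEntropy c K (κ * ε) := by rw [hcard]; rfl
  have hbound : (κ * ε) ^ 2 / σ ^ 2 ≤ Real.log S.card / 2 := by
    rw [hSe]
    refine le_trans ?_ (div_le_div_of_nonneg_right hmono (by norm_num))
    have h1 : (κ * (3 * L)) ^ 2 ≤ (c * constC c) ^ 2 := pow_le_pow_left₀ (by positivity) hκL 2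
    rw [div_le_iff₀ (by positivity)] at hent
    have h2 : (c * constC c) ^ 2 * ε ^ 2 ≤ 4 * L ^ 2 * σ ^ 2 * localEntropy c K ε := by
      calc (c * constC c) ^ 2 * ε ^ 2 = c ^ 2 * (constC c ^ 2 * ε ^ 2) := by ring
        _ ≤ c ^ 2 * ((L / c) ^ 2 * localEntropy c K ε * (4 * σ ^ 2)) := by gcongr
        _ = _ := by field_simp
    have h3 : 9 * L ^ 2 * (κ * ε) ^ 2 ≤ 4 * L ^ 2 * σ ^ 2 * localEntropy c K ε := by
      refine le_trans ?_ h2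
      calc 9 * L ^ 2 * (κ * ε) ^ 2 = (κ * (3 * L)) ^ 2 * ε ^ 2 := by ring
        _ ≤ _ := by gcongr
    have h4 := localEntropy_nonneg c K ε
    rw [div_le_iff₀ (by positivity)]
    have h5 : L ^ 2 * (9 * (κ * ε) ^ 2) ≤ L ^ 2 * (4 * σ ^ 2 * localEntropy c K ε) := by linarith
    have h6 := le_of_mul_le_mul_left h5 (by positivity)
    nlinarith [mul_nonneg (sq_nonneg σ) h4]
  have hcard2 : 2 ≤ S.card := by
    by_contra! hlt
    have h0 : Real.log S.card = 0 := by
      interval_cases S.card <;> simp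
    rw [h0, zero_div] at hbound
    have : 0 < (κ * ε) ^ 2 / σ ^ 2 := by positivity
    linarith
  have h7 := le_worstCaseRate_of_packing hK hconv hσ (div_pos hκε hc0) hS hsep hcard2 hbound
  calc ε = 8 * (c * constC c + 3 * L) / constC c * (κ * ε / c / 8) := by
        rw [hκ]; field_simp
    _ ≤ _ := by gcongr

end LowerRate

/-! ### Risk and increments of local widths. -/

section Local

variable {K : Set (E n)} {σ : ℝ}

/-- The centered support function of the local set `B(μ, r) ∩ K`. -/
abbrev localSupport (K : Set (E n)) (μ : E n) (r : ℝ) (v : E n) : E n → ℝ :=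
  centeredSupport (Metric.closedBall μ r ∩ K) v

lemma integral_localSupport (hK : IsCompact K) (hc : Convex ℝ K) {μ : E n} (hμ : μ ∈ K) {r : ℝ}
    (hr : 0 ≤ r) (v : E n) : ∫ x, localSupport K μ r v x ∂(gauss n) = localWidth K μ r :=
  integral_centeredSupport (isCompact_local hK μ r) (convex_local hc μ r) (nonempty_local hμ hr) v

lemma hasApproxSubgradients_localSupport (hK : IsCompact K) (hc : Convex ℝ K) {μ v : E n}
    (hμ : μ ∈ K) {r s : ℝ} (hr : 0 ≤ r) (h : dist μ v + r ≤ s) :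
    HasApproxSubgradients (localSupport K μ r v) s := by
  refine hasApproxSubgradients_centeredSupport (isCompact_local hK μ r) (convex_local hc μ r)
    (nonempty_local hμ hr) fun t ht => ?_
  have h1 : dist t μ ≤ r := ht.1
  have h2 := dist_triangle t μ v
  rw [Metric.mem_closedBall]
  linarith

/-- The variational inequality for the least squares estimator, in terms of the noise. -/
lemma inner_noise_le (hK : IsCompact K) (hc : Convex ℝ K) {ν t : E n} (hν : ν ∈ K) (ht : t ∈ K)
    (x : E n) :
    σ * inner ℝ x (t - ν) ≤ σ * inner ℝ x (lse K (ν + σ • x) - ν) +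
      (‖lse K (ν + σ • x) - ν‖ * ‖t - ν‖ - ‖lse K (ν + σ • x) - ν‖ ^ 2) := by
  have h := lse_inner_le hK hc ⟨ν, hν⟩ (ν + σ • x) ht
  set q := lse K (ν + σ • x)
  have e1 : ν + σ • x - q = σ • x - (q - ν) := by abel
  have e2 : t - q = (t - ν) - (q - ν) := by abel
  rw [e1, e2, inner_sub_left, inner_sub_right (σ • x), inner_sub_right (q - ν),
    real_inner_smul_left, real_inner_smul_left, real_inner_self_eq_norm_sq] at h
  have := real_inner_le_norm (q - ν) (t - ν)
  linarith

lemma localSupport_mono (hK : IsCompact K) {ν : E n} (hν : ν ∈ K) {s ε : ℝ} (hs : 0 ≤ s)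
    (h : s ≤ ε) (v x : E n) : localSupport K ν s v x ≤ localSupport K ν ε v x :=
  centeredSupport_le (nonempty_local hν hs) fun _ ht =>
    inner_sub_le_centeredSupport (isCompact_local hK ν ε) v x
      ⟨Metric.closedBall_subset_closedBall h ht.1, ht.2⟩

/-- The error of the least squares estimator is controlled by an increment of the localized
support function. -/
lemma norm_lse_sub_le_increment (hK : IsCompact K) (hc : Convex ℝ K) (hσ : 0 < σ) {ν : E n}
    (hν : ν ∈ K) {s ε : ℝ} (hs : 0 ≤ s) (hsε : s < ε) (x : E n) :
    (ε - s) * ‖lse K (ν + σ • x) - ν‖ ≤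
      (ε - s) * ε + σ * (localSupport K ν ε ν x - localSupport K ν s ν x) := by
  have hmono := localSupport_mono hK hν hs hsε.le ν x
  set q := lse K (ν + σ • x) with hq
  set D := ‖q - ν‖ with hD
  set Fε := localSupport K ν ε ν x with hFε
  set Fs := localSupport K ν s ν x with hFs
  have hd : 0 < ε - s := by linarith
  rcases le_or_gt D ε with hle | hlt
  · have h1 := mul_le_mul_of_nonneg_left hle hd.le
    have h2 := mul_nonneg hσ.le (sub_nonneg.2 hmono)
    linarith
  have hqK : q ∈ K := lse_mem hK ⟨ν, hν⟩ _
  have hε0 : 0 < ε := hs.trans_lt hsε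
  have hDs : 0 < D - s := by linarith
  have h1 : σ * Fε ≤ σ * inner ℝ x (q - ν) + (D * ε - D ^ 2) := by
    obtain ⟨t, ht, htF⟩ := exists_inner_sub_eq_centeredSupport (isCompact_local hK ν ε)
      (nonempty_local hν hε0.le) ν x
    rw [hFε, localSupport, htF]
    have h2 := inner_noise_le (σ := σ) hK hc hν ht.2 x
    have h3 : ‖t - ν‖ ≤ ε := by rw [← dist_eq_norm]; exact ht.1
    have h4 := mul_le_mul_of_nonneg_left h3 (norm_nonneg (q - ν))
    rw [← hq, ← hD] at h2
    linarith
  -- For `t` in the small ball, the point of the segment from `t` to `q` with weight `α = (ε - s) /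
  -- (D - s)` lies in `K` and within `(1 - α) * s + α * D = ε` of `ν`. This bounds the noise at `q`
  -- from above; `h1` bounds it from below, and the common factor `D - ε` cancels.
  have h2 : (D - ε) * Fs + (ε - s) * inner ℝ x (q - ν) ≤ (D - s) * Fε := by
    obtain ⟨t, ht, htF⟩ := exists_inner_sub_eq_centeredSupport (isCompact_local hK ν s)
      (nonempty_local hν hs) ν x
    rw [hFs, localSupport, htF]
    set α := (ε - s) / (D - s) with hα
    have hα0 : 0 ≤ α := div_nonneg hd.le hDs.le
    have hα1 : α ≤ 1 := (div_le_one hDs).2 (by linarith)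
    have hαD : α * (D - s) = ε - s := div_mul_cancel₀ _ hDs.ne'
    have hz : t + α • (q - t) ∈ K := hc.add_smul_sub_mem ht.2 hqK ⟨hα0, hα1⟩
    have e1 : t + α • (q - t) - ν = (1 - α) • (t - ν) + α • (q - ν) := by module
    have h3 : ‖t - ν‖ ≤ s := by rw [← dist_eq_norm]; exact ht.1
    have hzb : t + α • (q - t) ∈ Metric.closedBall ν ε := by
      rw [Metric.mem_closedBall, dist_eq_norm, e1]
      refine (norm_add_le _ _).trans ?_
      rw [norm_smul, norm_smul, Real.norm_of_nonneg hα0, Real.norm_of_nonneg (sub_nonneg.2 hα1)]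
      have := mul_le_mul_of_nonneg_left h3 (sub_nonneg.2 hα1)
      nlinarith
    have h4 := inner_sub_le_centeredSupport (isCompact_local hK ν ε) ν x ⟨hzb, hz⟩
    rw [e1, inner_add_right, real_inner_smul_right, real_inner_smul_right] at h4
    have h5 := mul_le_mul_of_nonneg_left h4 hDs.le
    have h6 : (D - s) * ((1 - α) * inner ℝ x (t - ν) + α * inner ℝ x (q - ν)) =
        (D - ε) * inner ℝ x (t - ν) + (ε - s) * inner ℝ x (q - ν) := by
      rw [← hαD]
      have : D - ε = D - s - α * (D - s) := by rw [hαD]; ring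
      rw [this]; ring
    linarith
  have h3 : (D - ε) * ((ε - s) * D) ≤ (D - ε) * (σ * (Fε - Fs)) := by
    have h4 := mul_le_mul_of_nonneg_left h2 hσ.le
    have h5 := mul_le_mul_of_nonneg_left h1 hd.le
    linarith
  have h4 := le_of_mul_le_mul_left h3 (by linarith)
  have h5 := mul_pos hd hε0
  linarith

/-- The risk is controlled by an increment of the local width. -/
lemma risk_le_of_localWidth_le (hK : IsCompact K) (hc : Convex ℝ K) (hσ : 0 < σ) {ν : E n}
    (hν : ν ∈ K) {s ε B : ℝ} (hs : 0 ≤ s) (hsε : s < ε)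
    (hB : localWidth K ν ε ≤ localWidth K ν s + B) :
    risk K σ ν ≤ 2 * ε ^ 2 + 6 * (σ / (ε - s)) ^ 2 * (32 * ε ^ 2 + B ^ 2) := by
  have hd : 0 < ε - s := by linarith
  have hε0 : 0 < ε := hs.trans_lt hsε
  have hFε := hasApproxSubgradients_localSupport hK hc (v := ν) hν hε0.le (s := ε) (by simp)
  have hFs := hasApproxSubgradients_localSupport hK hc (v := ν) hν hs (s := s) (by simp)
  have hvε := hFε.integral_sub_sq_le
  have hvs := hFs.integral_sub_sq_le
  rw [integral_localSupport hK hc hν hε0.le] at hvε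
  rw [integral_localSupport hK hc hν hs] at hvs
  have hmono : localWidth K ν s ≤ localWidth K ν ε := by
    rw [← integral_localSupport hK hc hν hs ν, ← integral_localSupport hK hc hν hε0.le ν]
    exact integral_mono hFs.integrable hFε.integrable fun x =>
      localSupport_mono hK hν hs hsε.le ν x
  have hiε := hFε.integrable_sub_sq (localWidth K ν ε)
  have his := hFs.integrable_sub_sq (localWidth K ν s)
  have hpt : ∀ x, ‖lse K (ν + σ • x) - ν‖ ^ 2 ≤ (2 * ε ^ 2 + 6 * (σ / (ε - s)) ^ 2 * B ^ 2) +
      6 * (σ / (ε - s)) ^ 2 * ((localSupport K ν ε ν x - localWidth K ν ε) ^ 2 +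
        (localSupport K ν s ν x - localWidth K ν s) ^ 2) := fun x => by
    have h1 := norm_lse_sub_le_increment hK hc hσ hν hs hsε x
    set D := ‖lse K (ν + σ • x) - ν‖
    set a := localSupport K ν ε ν x
    set b := localSupport K ν s ν x
    have h2 : D ≤ ε + σ / (ε - s) * (a - b) := by
      have e : ε + σ / (ε - s) * (a - b) = ((ε - s) * ε + σ * (a - b)) / (ε - s) := by
        field_simp
      rw [e, le_div_iff₀ hd]
      linarith
    have h3 : D ^ 2 ≤ (ε + σ / (ε - s) * (a - b)) ^ 2 := pow_le_pow_left₀ (norm_nonneg _) h2 2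
    have h4 : (a - b) ^ 2 ≤ 3 * ((a - localWidth K ν ε) ^ 2 + (b - localWidth K ν s) ^ 2 +
        B ^ 2) := by
      have h5 : (localWidth K ν ε - localWidth K ν s) ^ 2 ≤ B ^ 2 :=
        pow_le_pow_left₀ (by linarith) (by linarith) 2
      set p := a - localWidth K ν ε
      set q := b - localWidth K ν s
      set r := localWidth K ν ε - localWidth K ν s
      have e : a - b = p - q + r := by simp only [p, q, r]; ring
      rw [e]
      nlinarith [sq_nonneg (p + q), sq_nonneg (p - r), sq_nonneg (q + r)]
    have h6 : (ε + σ / (ε - s) * (a - b)) ^ 2 ≤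
        2 * ε ^ 2 + 2 * (σ / (ε - s)) ^ 2 * (a - b) ^ 2 := by
      nlinarith [sq_nonneg (ε - σ / (ε - s) * (a - b))]
    have h7 := mul_le_mul_of_nonneg_left h4 (by positivity : 0 ≤ 2 * (σ / (ε - s)) ^ 2)
    linarith
  have hisum : Integrable (fun x => (localSupport K ν ε ν x - localWidth K ν ε) ^ 2 +
      (localSupport K ν s ν x - localWidth K ν s) ^ 2) (gauss n) := hiε.add his
  refine (risk_le_of_forall hK hc hν ((integrable_const _).add (hisum.const_mul _)) hpt).trans ?_
  rw [integral_add' (integrable_const _) (hisum.const_mul _), integral_const,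
    probReal_univ, one_smul, integral_const_mul, integral_add hiε his]
  have h8 : (∫ x, (localSupport K ν ε ν x - localWidth K ν ε) ^ 2 ∂(gauss n)) +
      ∫ x, (localSupport K ν s ν x - localWidth K ν s) ^ 2 ∂(gauss n) ≤ 32 * ε ^ 2 := by
    have : s ^ 2 ≤ ε ^ 2 := pow_le_pow_left₀ hs hsε.le 2
    linarith
  have h9 := mul_le_mul_of_nonneg_left h8 (by positivity : 0 ≤ 6 * (σ / (ε - s)) ^ 2)
  linarith

/-- One step of chaining: the local width at scale `ε` is at most the largest local width at scale
`ε / c` at nearby points, up to an entropy term. -/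
lemma localWidth_le_of_forall (hK : IsCompact K) (hconv : Convex ℝ K) {c : ℝ} (hc : 1 < c)
    {ν : E n} (hν : ν ∈ K) {ε W l : ℝ} (hε : 0 < ε) (hl : 0 < l)
    (hW : ∀ ν' ∈ Metric.closedBall ν ε ∩ K, localWidth K ν' (ε / c) ≤ W) :
    localWidth K ν ε ≤ W + localEntropy c K ε / l + 5 * l * ε ^ 2 := by
  have hc0 : 0 < c := by linarith
  have hs : 0 < ε / c := div_pos hε hc0
  have hsε : ε / c ≤ ε := (div_lt_self hε hc).le
  obtain ⟨Q, hQ⟩ := exists_isMaximalPacking hK hs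
    (Set.inter_subset_right (s := Metric.closedBall ν ε) (t := K))
  have hQne : Q.Nonempty := hQ.nonempty hs.le (nonempty_local hν hε.le)
  -- Balls of radius `ε / c` about the packing points cover the local set, so its support function
  -- is at most the maximum over the pieces. Centred at `ν`, each piece is Lipschitz with constant
  -- `2 * ε`.
  have h1 := HasApproxSubgradients.integral_le_of_le_max (s := 2 * ε) Q hQne
    (fun j => localSupport K j (ε / c) ν)
    (fun j hj => hasApproxSubgradients_localSupport hK hconv (hQ.1 hj).2 hs.le (by
      have : dist j ν ≤ ε := (hQ.1 hj).1
      linarith))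
    (m := W) (fun j hj => by
      rw [integral_localSupport hK hconv (hQ.1 hj).2 hs.le]
      exact hW j (hQ.1 hj))
    (H := localSupport K ν ε ν)
    (hasApproxSubgradients_localSupport hK hconv hν hε.le le_rfl).integrable
    (fun x => by
      obtain ⟨t, ht, htF⟩ := exists_inner_sub_eq_centeredSupport (isCompact_local hK ν ε)
        (nonempty_local hν hε.le) ν x
      obtain ⟨j, hj, hd⟩ := hQ.exists_dist_le hs.le ht
      refine ⟨j, hj, ?_⟩
      rw [localSupport, htF]
      exact inner_sub_le_centeredSupport (isCompact_local hK j _) ν x ⟨hd, ht.2⟩) hl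
  rw [integral_localSupport hK hconv hν hε.le] at h1
  have h2 : Real.log Q.card ≤ localEntropy c K ε := by
    have h3 := card_le_localCount hK hc0 hε hν hQ.1 fun x hx y hy hxy => hQ.lt_dist hs.le hx hy hxy
    exact Real.log_le_log (by exact_mod_cast hQne.card_pos) (by exact_mod_cast h3)
  have h3 : Real.log Q.card / l ≤ localEntropy c K ε / l := by gcongr
  have h4 : Real.pi ^ 2 * l * (2 * ε) ^ 2 / 8 ≤ 5 * l * ε ^ 2 := by
    have h5 : Real.pi ^ 2 ≤ 10 := by nlinarith [Real.pi_lt_d2, Real.pi_pos]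
    have h6 : 0 ≤ l * ε ^ 2 := by positivity
    nlinarith
  linarith

/-- If the risk is small, then the local width cannot vary much. -/
lemma localWidth_sub_le (hK : IsCompact K) (hconv : Convex ℝ K) (hσ : 0 < σ) {ν ν' : E n}
    (hν : ν ∈ K) (hν' : ν' ∈ K) {s ε : ℝ} (hs : 0 < s) (hsε : s ≤ ε) (hdist : dist ν' ν ≤ 2 * ε)
    (hR : 0 < worstCaseRate K σ) (hRs : 2 * worstCaseRate K σ ≤ s) :
    localWidth K ν' s - localWidth K ν s ≤ 8 * worstCaseRate K σ * ε / σ + 28 * ε := by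
  set R := worstCaseRate K σ with hRdef
  have hε : 0 < ε := hs.trans_le hsε
  have hF := hasApproxSubgradients_localSupport hK hconv (v := ν) hν hs.le (s := s) (by simp)
  have hG := hasApproxSubgradients_localSupport hK hconv (v := ν) hν' hs.le (s := 3 * ε)
    (by linarith)
  have hvF := hF.integral_sub_sq_le
  have hvG := hG.integral_sub_sq_le
  rw [integral_localSupport hK hconv hν hs.le] at hvF
  rw [integral_localSupport hK hconv hν' hs.le] at hvG
  have hiF := (hF.integrable_sub_sq (localWidth K ν s)).div_const (16 * ε ^ 2)
  have hiG := (hG.integrable_sub_sq (localWidth K ν' s)).div_const (144 * ε ^ 2)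
  have hiD := (integrable_lse_sq (σ := σ) hK hconv hν).div_const (R ^ 2)
  have hiDF : Integrable (fun x => ‖lse K (ν + σ • x) - ν‖ ^ 2 / R ^ 2 +
      (localSupport K ν s ν x - localWidth K ν s) ^ 2 / (16 * ε ^ 2)) (gauss n) := hiD.add hiF
  have hisum : Integrable (fun x => ‖lse K (ν + σ • x) - ν‖ ^ 2 / R ^ 2 +
      (localSupport K ν s ν x - localWidth K ν s) ^ 2 / (16 * ε ^ 2) +
      (localSupport K ν' s ν x - localWidth K ν' s) ^ 2 / (144 * ε ^ 2)) (gauss n) := hiDF.add hiG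
  -- The sum of the three normalised squares has mean at most 3, so a single noise vector keeps the
  -- error and both fluctuations within √3 of their scales. This gives `2 * R`, `7 * ε` and `21 *
  -- ε`, whence 28. As `2 * R ≤ s`, the projection stays in the small ball about `ν`.
  obtain ⟨x, hx⟩ := exists_le_integral hisum
  have hint : ∫ x, (‖lse K (ν + σ • x) - ν‖ ^ 2 / R ^ 2 +
      (localSupport K ν s ν x - localWidth K ν s) ^ 2 / (16 * ε ^ 2) +
      (localSupport K ν' s ν x - localWidth K ν' s) ^ 2 / (144 * ε ^ 2)) ∂(gauss n) ≤ 3 := by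
    rw [integral_add hiDF hiG, integral_add hiD hiF, integral_div, integral_div, integral_div]
    have h1 : (∫ a, ‖lse K (ν + σ • a) - ν‖ ^ 2 ∂(gauss n)) / R ^ 2 ≤ 1 := by
      rw [div_le_one (by positivity)]
      exact risk_le_worstCaseRate_sq hK hconv hν
    have h2 : (∫ a, (localSupport K ν s ν a - localWidth K ν s) ^ 2 ∂(gauss n)) /
        (16 * ε ^ 2) ≤ 1 := by
      rw [div_le_one (by positivity)]
      exact hvF.trans (by gcongr)
    have h3 : (∫ a, (localSupport K ν' s ν a - localWidth K ν' s) ^ 2 ∂(gauss n)) /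
        (144 * ε ^ 2) ≤ 1 := by
      rw [div_le_one (by positivity)]
      exact hvG.trans (by ring_nf; rfl)
    linarith
  replace hx := hx.trans hint
  set q := lse K (ν + σ • x) with hq
  set D := ‖q - ν‖ with hD
  set f := localSupport K ν s ν x with hf
  set g := localSupport K ν' s ν x with hg
  have hD0 : 0 ≤ D := norm_nonneg _
  have p1 : 0 ≤ D ^ 2 / R ^ 2 := by positivity
  have p2 : 0 ≤ (f - localWidth K ν s) ^ 2 / (16 * ε ^ 2) := by positivity
  have p3 : 0 ≤ (g - localWidth K ν' s) ^ 2 / (144 * ε ^ 2) := by positivity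
  have hDR : D ≤ 2 * R := by
    have h1 : D ^ 2 / R ^ 2 ≤ 3 := by linarith
    rw [div_le_iff₀ (by positivity)] at h1
    exact abs_le_of_sq_le_sq' (by nlinarith) (by positivity) |>.2
  have hfd : f - localWidth K ν s ≤ 7 * ε := by
    have h1 : (f - localWidth K ν s) ^ 2 / (16 * ε ^ 2) ≤ 3 := by linarith
    rw [div_le_iff₀ (by positivity)] at h1
    exact abs_le_of_sq_le_sq' (by nlinarith) (by positivity) |>.2
  have hgd : -(21 * ε) ≤ g - localWidth K ν' s := by
    have h1 : (g - localWidth K ν' s) ^ 2 / (144 * ε ^ 2) ≤ 3 := by linarith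
    rw [div_le_iff₀ (by positivity)] at h1
    exact abs_le_of_sq_le_sq' (by nlinarith) (by positivity) |>.1
  have hqK : q ∈ K := lse_mem hK ⟨ν, hν⟩ _
  have h1 : inner ℝ x (q - ν) ≤ f :=
    inner_sub_le_centeredSupport (isCompact_local hK ν s) ν x
      ⟨by rw [Metric.mem_closedBall, dist_eq_norm]; linarith, hqK⟩
  have h2 : σ * g ≤ σ * f + 8 * R * ε := by
    obtain ⟨t, ht, htF⟩ := exists_inner_sub_eq_centeredSupport (isCompact_local hK ν' s)
      (nonempty_local hν' hs.le) ν x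
    rw [hg, localSupport, htF]
    have h3 := inner_noise_le (σ := σ) hK hconv hν ht.2 x
    rw [← hq, ← hD] at h3
    have h4 : ‖t - ν‖ ≤ 3 * ε := by
      rw [← dist_eq_norm]
      have h5 : dist t ν' ≤ s := ht.1
      have := dist_triangle t ν' ν
      linarith
    have h5 : D * ‖t - ν‖ ≤ 2 * R * (3 * ε) := mul_le_mul hDR h4 (norm_nonneg _) (by positivity)
    have h6 := mul_le_mul_of_nonneg_left h1 hσ.le
    nlinarith [mul_pos hR hε, sq_nonneg D]
  have h3 : g - f ≤ 8 * R * ε / σ := by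
    rw [le_div_iff₀ hσ]
    linarith
  linarith

/-- Local widths of nontrivial convex sets are positive. -/
lemma localWidth_pos (hK : IsCompact K) (hconv : Convex ℝ K) (hnt : K.Nontrivial) {ν : E n}
    (hν : ν ∈ K) {r : ℝ} (hr : 0 < r) : 0 < localWidth K ν r := by
  obtain ⟨t, ht, htν⟩ := hnt.exists_ne ν
  set a := min 1 (r / ‖t - ν‖) with ha
  have hn : 0 < ‖t - ν‖ := norm_pos_iff.2 (sub_ne_zero.2 htν)
  have ha0 : 0 < a := lt_min one_pos (div_pos hr hn)
  set u := a • (t - ν) with hu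
  have hu0 : u ≠ 0 := smul_ne_zero ha0.ne' (sub_ne_zero.2 htν)
  have hmem : ν + u ∈ Metric.closedBall ν r ∩ K := by
    refine ⟨?_, hconv.add_smul_sub_mem hν ht ⟨ha0.le, min_le_left _ _⟩⟩
    rw [Metric.mem_closedBall, dist_eq_norm, add_sub_cancel_left, hu, norm_smul,
      Real.norm_of_nonneg ha0.le, ← le_div_iff₀ hn]
    exact min_le_right _ _
  have hF := hasApproxSubgradients_localSupport hK hconv (v := ν) hν hr.le (s := r) (by simp)
  have h0 : ∀ x, 0 ≤ localSupport K ν r ν x := fun x => by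
    have := inner_sub_le_centeredSupport (isCompact_local hK ν r) ν x
      (⟨Metric.mem_closedBall_self hr.le, hν⟩ : ν ∈ Metric.closedBall ν r ∩ K)
    simpa using this
  have h1 : ∀ x, inner ℝ x u ≤ localSupport K ν r ν x := fun x => by
    have := inner_sub_le_centeredSupport (isCompact_local hK ν r) ν x hmem
    simpa using this
  rw [← integral_localSupport hK hconv hν hr.le ν]
  refine lt_of_le_of_ne (integral_nonneg h0) fun heq => ?_
  have h2 := (integral_eq_zero_iff_of_nonneg h0 hF.integrable).1 heq.symm
  have h3 : (fun x => localSupport K ν r ν x - inner ℝ x u) =ᵐ[gauss n] 0 := by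
    refine (integral_eq_zero_iff_of_nonneg (fun x => sub_nonneg.2 (h1 x))
      (hF.integrable.sub (integrable_inner_gauss u))).1 ?_
    rw [integral_sub hF.integrable (integrable_inner_gauss u), ← heq, integral_inner_gauss, sub_zero]
  -- Zero width would force `inner ℝ x u = 0` almost surely, contradicting the exponential moment of
  -- a nonzero `u`.
  have h4 : ∫ x : E n, Real.exp (inner ℝ u x) ∂(gauss n) = ∫ _ : E n, (1 : ℝ) ∂(gauss n) := by
    refine integral_congr_ae ?_
    filter_upwards [h2, h3] with x hx hx'
    simp only [Pi.zero_apply] at hx hx'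
    rw [hx, zero_sub, neg_eq_zero] at hx'
    rw [real_inner_comm, hx', Real.exp_zero]
  rw [integral_exp_inner, integral_const, probReal_univ, one_smul, Real.exp_eq_one_iff] at h4
  have : 0 < ‖u‖ := norm_pos_iff.2 hu0
  have : 0 < ‖u‖ ^ 2 / 2 := by positivity
  linarith

end Local

/-! ### Consequences of the loop condition, and termination. -/

section Algorithm

variable {K : Set (E n)} {σ c L : ℝ}

lemma packRadius_le (ε : ℝ) : packRadius c K σ ε ≤ ε := min_le_right _ _

lemma packRadius_pos (hK : IsCompact K) (hconv : Convex ℝ K) (hnt : K.Nontrivial) (hc : 0 < c)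
    (hσ : 0 < σ) {ε : ℝ} (hε : 0 < ε) : 0 < packRadius c K σ ε := by
  have hs : 0 < ε / c := div_pos hε hc
  obtain ⟨ν, hν⟩ := hnt.nonempty
  have h1 := le_ciSup (bddAbove_localWidth hK hconv hs.le) (⟨ν, hν⟩ : K)
  have h2 : 0 < ⨆ η : K, localWidth K η (ε / c) :=
    (localWidth_pos hK hconv hnt hν hs).trans_le h1
  exact lt_min (by positivity) hε

lemma bddAbove_localWidth_inter (hK : IsCompact K) (hconv : Convex ℝ K) {s : ℝ} (hs : 0 ≤ s)
    (B : Set (E n)) : BddAbove (Set.range fun ν' : ↥(B ∩ K) => localWidth K ν' s) := by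
  refine (bddAbove_localWidth hK hconv hs).mono ?_
  rintro _ ⟨ν', rfl⟩
  exact ⟨⟨ν', ν'.2.2⟩, rfl⟩

lemma localWidth_sub_le_Psi (hK : IsCompact K) (hconv : Convex ℝ K) (hc : 0 < c) {ε : ℝ}
    (hε : 0 < ε) {P : Finset (E n)} {ν ν' : E n} (hν : ν ∈ P)
    (hν' : ν' ∈ Metric.closedBall ν (2 * ε - packRadius c K σ ε) ∩ K) :
    localWidth K ν' (ε / c) - localWidth K ν (ε / c) ≤ Psi c K σ ε P := by
  have h1 := le_ciSup (bddAbove_localWidth_inter hK hconv (div_pos hε hc).le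
    (Metric.closedBall ν (2 * ε - packRadius c K σ ε))) ⟨ν', hν'⟩
  have h2 := le_ciSup (f := fun ν : P =>
    ((⨆ ν' : ↥(Metric.closedBall (ν : E n) (2 * ε - packRadius c K σ ε) ∩ K),
        localWidth K ν' (ε / c)) - localWidth K ν (ε / c))) (Set.finite_range _).bddAbove ⟨ν, hν⟩
  exact (sub_le_sub_right h1 _).trans h2

lemma exists_lt_localWidth_sub_of_lt_Psi {ε : ℝ} (hε : 0 < ε) {P : Finset (E n)}
    (hP : P.Nonempty) (hPK : (P : Set (E n)) ⊆ K) {a : ℝ} (h : a < Psi c K σ ε P) :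
    ∃ ν ∈ K, ∃ ν' ∈ K, dist ν' ν ≤ 2 * ε - packRadius c K σ ε ∧
      a < localWidth K ν' (ε / c) - localWidth K ν (ε / c) := by
  have : Nonempty P := hP.to_subtype
  obtain ⟨ν, hν⟩ := exists_lt_of_lt_ciSup h
  have hνK : (ν : E n) ∈ K := hPK ν.2
  have : Nonempty ↥(Metric.closedBall (ν : E n) (2 * ε - packRadius c K σ ε) ∩ K) :=
    (nonempty_local hνK (by linarith [packRadius_le (c := c) (K := K) (σ := σ) ε])).to_subtype
  obtain ⟨ν', hν'⟩ := exists_lt_of_lt_ciSup (lt_sub_iff_add_lt.1 hν)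
  exact ⟨ν, hνK, ν', ν'.2.2, ν'.2.1, by linarith⟩

/-- The constant in the increment bound for the local widths. -/
def incrementConst (c L : ℝ) : ℝ := constC c / 2 + (c * constC c / L) ^ 2 / 4 + 5

/-- The constant in the upper bound for the worst case rate by `ε + σ`. -/
def upperConst (c L : ℝ) : ℝ := 12 + 12 * (c / (c - 1)) ^ 2 * (32 + incrementConst c L ^ 2)

/-- If the loop condition fails at `ε`, the worst case rate is at most of order `ε + σ`. -/
theorem worstCaseRate_le_of_Psi_lt (hK : IsCompact K) (hconv : Convex ℝ K) (hnt : K.Nontrivial)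
    (hc : 1 < c) (hL : 0 < L) (hσ : 0 < σ) {ε : ℝ} (hε : 0 < ε) (hlr : lowerRate c L K σ < ε)
    {P : Finset (E n)} (hP : IsMaximalPacking (packRadius c K σ ε) K P)
    (h : Psi c K σ ε P < threshold c L K σ ε) :
    worstCaseRate K σ ≤ upperConst c L * (ε + σ) := by
  have hc0 : 0 < c := by linarith
  have hC := constC_pos hc0
  have hent := localEntropy_lt_of_lowerRate_lt hK hnt.nonempty hc0 hσ hε hlr
  have hent0 := localEntropy_nonneg c K ε
  have hs : 0 < ε / c := div_pos hε hc0
  have hsε : ε / c < ε := div_lt_self hε hc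
  have hδ := packRadius_pos hK hconv hnt hc0 hσ hε
  have hδε := packRadius_le (c := c) (K := K) (σ := σ) ε
  set β := incrementConst c L with hβ
  set κ := c / (c - 1) with hκ
  have hT : threshold c L K σ ε ≤ constC c * ε ^ 2 / (2 * σ) := by
    have : 0 ≤ L / c * ε * Real.sqrt (localEntropy c K ε) := by positivity
    rw [threshold]
    linarith
  have hentσ : localEntropy c K ε * σ ≤ (c * constC c / L) ^ 2 / 4 * (ε ^ 2 / σ) := by
    rw [lt_div_iff₀ (by positivity)] at hent
    have e : (c * constC c / L) ^ 2 / 4 * (ε ^ 2 / σ) =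
        (c / L) ^ 2 * (constC c ^ 2 * ε ^ 2) / (4 * σ) := by field_simp
    rw [e, le_div_iff₀ (by positivity)]
    calc localEntropy c K ε * σ * (4 * σ) =
        (c / L) ^ 2 * ((L / c) ^ 2 * localEntropy c K ε * (4 * σ ^ 2)) := by field_simp
      _ ≤ _ := by gcongr
  have hcentre : ∀ ν ∈ P, risk K σ ν ≤ 2 * ε ^ 2 + 6 * κ ^ 2 * (32 * σ ^ 2 + β ^ 2 * ε ^ 2) := by
    intro ν hν
    have hνK : ν ∈ K := hP.1 hν
    -- The choice `l = 1 / σ` makes the entropy term and the fluctuation term both of order `ε ^ 2 /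
    -- σ`. The ball of radius `ε` lies in that of radius `2 * ε - δ` because `δ ≤ ε`.
    have h1 := localWidth_le_of_forall hK hconv hc hνK hε (inv_pos.2 hσ)
      (W := localWidth K ν (ε / c) + constC c * ε ^ 2 / (2 * σ)) fun ν' hν' => by
        have h2 := localWidth_sub_le_Psi (σ := σ) hK hconv hc0 hε hν (ν' := ν')
          ⟨Metric.closedBall_subset_closedBall (by linarith) hν'.1, hν'.2⟩
        linarith
    rw [div_inv_eq_mul] at h1
    have h2 : localWidth K ν ε ≤ localWidth K ν (ε / c) + β * (ε ^ 2 / σ) := by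
      have e : β * (ε ^ 2 / σ) = constC c * ε ^ 2 / (2 * σ) +
          (c * constC c / L) ^ 2 / 4 * (ε ^ 2 / σ) + 5 * σ⁻¹ * ε ^ 2 := by
        rw [hβ, incrementConst]
        field_simp
      linarith
    have h3 := risk_le_of_localWidth_le hK hconv hσ hνK hs.le hsε h2
    have hc1 : c - 1 ≠ 0 := by linarith
    have hκε : σ / (ε - ε / c) = κ * (σ / ε) := by
      have : ε - ε / c = ε * (c - 1) / c := by field_simp
      rw [this, hκ]
      field_simp
    rw [hκε] at h3
    refine h3.trans (le_of_eq ?_)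
    field_simp
  have hU : 1 ≤ upperConst c L := by
    rw [upperConst]
    have : 0 ≤ 12 * (c / (c - 1)) ^ 2 * (32 + incrementConst c L ^ 2) := by positivity
    linarith
  refine worstCaseRate_le hnt.nonempty (by positivity) fun μ hμ => ?_
  -- The means `μ` and `ν` are coupled through the same noise; nonexpansiveness lets the two errors
  -- differ by at most `2 * ε`.
  obtain ⟨ν, hν, hd⟩ := hP.exists_dist_le hδ.le hμ
  have hνK : ν ∈ K := hP.1 hν
  have hpt : ∀ x, ‖lse K (μ + σ • x) - μ‖ ^ 2 ≤ 2 * ‖lse K (ν + σ • x) - ν‖ ^ 2 + 8 * ε ^ 2 := by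
    intro x
    have h1 := norm_lse_sub_le hK hconv hnt.nonempty (μ + σ • x) (ν + σ • x)
    rw [add_sub_add_right_eq_sub, ← dist_eq_norm μ ν] at h1
    have h2 : ‖lse K (μ + σ • x) - μ‖ ≤ ‖lse K (ν + σ • x) - ν‖ + 2 * ε := by
      have e : lse K (μ + σ • x) - μ = (lse K (μ + σ • x) - lse K (ν + σ • x)) +
          (lse K (ν + σ • x) - ν) + (ν - μ) := by abel
      rw [e]
      have h3 := norm_add₃_le (a := lse K (μ + σ • x) - lse K (ν + σ • x))
        (b := lse K (ν + σ • x) - ν) (c := ν - μ)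
      rw [← dist_eq_norm ν μ, dist_comm ν μ] at h3
      linarith
    have h3 := pow_le_pow_left₀ (norm_nonneg _) h2 2
    nlinarith [sq_nonneg (‖lse K (ν + σ • x) - ν‖ - 2 * ε)]
  have h1 := risk_le_of_forall hK hconv hμ
    (((integrable_lse_sq (σ := σ) hK hconv hνK).const_mul 2).add (integrable_const (8 * ε ^ 2))) hpt
  rw [integral_add' ((integrable_lse_sq (σ := σ) hK hconv hνK).const_mul 2)
    (integrable_const (8 * ε ^ 2)), integral_const_mul, integral_const, probReal_univ,
    one_smul] at h1
  have h2 : ∫ x, ‖lse K (ν + σ • x) - ν‖ ^ 2 ∂(gauss n) ≤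
      2 * ε ^ 2 + 6 * κ ^ 2 * (32 * σ ^ 2 + β ^ 2 * ε ^ 2) := hcentre ν hν
  have h3 : risk K σ μ ≤ upperConst c L * (ε + σ) ^ 2 := by
    have e1 : ε ^ 2 ≤ (ε + σ) ^ 2 := pow_le_pow_left₀ hε.le (by linarith) 2
    have e2 : σ ^ 2 ≤ (ε + σ) ^ 2 := pow_le_pow_left₀ hσ.le (by linarith) 2
    have e3 := mul_le_mul_of_nonneg_left e1 (by positivity : 0 ≤ 12 + 12 * κ ^ 2 * β ^ 2)
    have e4 := mul_le_mul_of_nonneg_left e2 (by positivity : 0 ≤ 12 * κ ^ 2 * 32)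
    rw [upperConst]
    linarith
  refine h3.trans ?_
  rw [mul_pow]
  exact mul_le_mul_of_nonneg_right (le_self_pow₀ hU two_ne_zero) (by positivity)

/-- If the loop condition holds at `ε`, then `ε` is at most of the order of the worst case rate
plus `σ`. -/
theorem le_worstCaseRate_of_threshold_le_Psi (hK : IsCompact K) (hconv : Convex ℝ K)
    (hnt : K.Nontrivial) (hc : 1 < c) (hL : 0 < L) (hσ : 0 < σ) {ε : ℝ}
    (hlr : 2 * lowerRate c L K σ ≤ ε) {P : Finset (E n)}
    (hP : IsMaximalPacking (packRadius c K σ ε) K P)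
    (h : threshold c L K σ ε ≤ Psi c K σ ε P) :
    ε ≤ (2 * c + 16) * worstCaseRate K σ + 56 * σ := by
  have hc0 : 0 < c := by linarith
  have hC := constC_pos hc0
  have hl0 := lowerRate_pos hK hconv hnt hc hL hσ
  have hε : 0 < ε := by linarith
  have hδ := packRadius_pos hK hconv hnt hc0 hσ hε
  have hR : 0 < worstCaseRate K σ := by
    have h1 := hl0.trans_le (lowerRate_le_worstCaseRate hK hconv hnt hc hL hσ)
    exact pos_of_mul_pos_right h1 (by positivity)
  -- If `ε < 2 * c * R` there is nothing left to prove; otherwise `2 * R ≤ ε / c`, as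
  -- `localWidth_sub_le` requires.
  rcases lt_or_ge (ε / c) (2 * worstCaseRate K σ) with hlt | hge
  · rw [div_lt_iff₀ hc0] at hlt
    linarith
  -- The entropy bound is applied at `3 / 4 * ε`, which is strictly above the lower rate since `ε`
  -- is at least twice it. The entropy term then takes at most three quarters of the main term, and
  -- `8 < constC c` makes the remaining quarter large enough.
  have hT : ε ^ 2 / (2 * σ) < threshold c L K σ ε := by
    have h1 := localEntropy_lt_of_lowerRate_lt hK hnt.nonempty hc0 hσ
      (by positivity : 0 < 3 / 4 * ε) (by linarith : lowerRate c L K σ < 3 / 4 * ε)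
    have h2 := localEntropy_anti hK hconv hnt.nonempty hc0 (by positivity : 0 < 3 / 4 * ε)
      (by linarith : 3 / 4 * ε ≤ ε)
    have h3 : L / c * Real.sqrt (localEntropy c K ε) ≤ 3 / 4 * (constC c * ε / (2 * σ)) := by
      refine abs_le_of_sq_le_sq' ?_ (by positivity) |>.2
      rw [mul_pow, Real.sq_sqrt (localEntropy_nonneg c K ε)]
      refine (mul_le_mul_of_nonneg_left h2 (by positivity)).trans (h1.le.trans (le_of_eq ?_))
      field_simp
      ring
    have h4 := mul_le_mul_of_nonneg_left h3 hε.le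
    have h5 : 8 < constC c := by
      rw [constC]
      have : 0 < 8 / c := by positivity
      linarith
    have h6 : 0 < ε ^ 2 / (2 * σ) := by positivity
    have e1 : constC c * ε ^ 2 / (2 * σ) = constC c * (ε ^ 2 / (2 * σ)) := by ring
    have e2 : ε * (3 / 4 * (constC c * ε / (2 * σ))) = 3 / 4 * (constC c * (ε ^ 2 / (2 * σ))) := by
      ring
    have h7 := mul_lt_mul_of_pos_right h5 h6
    rw [threshold, e1]
    linarith
  obtain ⟨ν, hν, ν', hν', hd, hw⟩ := exists_lt_localWidth_sub_of_lt_Psi hε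
    (hP.nonempty hδ.le hnt.nonempty) hP.1 (hT.trans_le h)
  have h1 := localWidth_sub_le hK hconv hσ hν hν' (div_pos hε hc0) (div_lt_self hε hc).le
    (by linarith) hR hge
  have h2 := hw.le.trans h1
  have h3 : ε ^ 2 ≤ ε * (16 * worstCaseRate K σ + 56 * σ) := by
    rw [div_le_iff₀ (by positivity)] at h2
    have e : (8 * worstCaseRate K σ * ε / σ + 28 * ε) * (2 * σ) =
        ε * (16 * worstCaseRate K σ + 56 * σ) := by
      field_simp
      ring
    linarith
  rw [sq] at h3
  have h4 := le_of_mul_le_mul_left h3 hε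
  have : 0 < c * worstCaseRate K σ := by positivity
  linarith

/-- The loop condition fails at scales beyond the diameter. -/
lemma Psi_lt_threshold_of_diam_le (hK : IsCompact K) (hconv : Convex ℝ K)
    (hnt : K.Nontrivial) (hc : 1 < c) (hσ : 0 < σ) {ε : ℝ} (hε : 0 < ε)
    (hd : Metric.diam K ≤ ε / c) {P : Finset (E n)}
    (hP : IsMaximalPacking (packRadius c K σ ε) K P) :
    Psi c K σ ε P < threshold c L K σ ε := by
  have hc0 : 0 < c := by linarith
  have hC := constC_pos hc0
  -- The entropy vanishes at this scale, so the threshold is positive. Balls of radius `ε / c` about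
  -- points of `K` contain `K`, so all local widths coincide and no increment can be positive.
  have hT : 0 < threshold c L K σ ε := by
    rw [threshold, localEntropy_eq_zero hK hnt.nonempty hc0 hε hd, Real.sqrt_zero, mul_zero,
      sub_zero]
    positivity
  by_contra! hle
  obtain ⟨ν, hν, ν', hν', -, hw⟩ := exists_lt_localWidth_sub_of_lt_Psi hε
    (hP.nonempty (packRadius_pos hK hconv hnt hc0 hσ hε).le hnt.nonempty) hP.1 (hT.trans_le hle)
  have hall : ∀ μ ∈ K, localWidth K μ (ε / c) = gaussianWidth K := fun μ hμ => by
    have hsub : K ⊆ Metric.closedBall μ (ε / c) := fun t ht =>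
      (Metric.dist_le_diam_of_mem hK.isBounded ht hμ).trans hd
    rw [localWidth, Set.inter_eq_self_of_subset_right hsub]
  rw [hall ν hν, hall ν' hν', sub_self] at hw
  exact lt_irrefl _ hw

lemma Visits.eq {P : ℕ → Finset (E n)} {k : ℕ} {ε : ℝ} (h : Visits c L K σ P k ε) :
    ε = 2 ^ k * (2 * lowerRate c L K σ) := by
  induction h with
  | init => simp
  | loop _ _ ih => rw [ih]; ring

lemma exists_validPackings (hK : IsCompact K) (hconv : Convex ℝ K) (hnt : K.Nontrivial)
    (hc : 1 < c) (hL : 0 < L) (hσ : 0 < σ) : ∃ P, ValidPackings c L K σ P := by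
  have hl0 := lowerRate_pos hK hconv hnt hc hL hσ
  choose P hP using fun k : ℕ => exists_isMaximalPacking hK
    (packRadius_pos (c := c) hK hconv hnt (by linarith) hσ
      (by positivity : 0 < 2 ^ k * (2 * lowerRate c L K σ))) (subset_refl K)
  exact ⟨P, fun k ε h => h.eq ▸ hP k⟩

/-- The starting value is positive, so a run that never stops would double past `c` times the
diameter, where the loop condition fails. -/
lemma exists_returns (hK : IsCompact K) (hconv : Convex ℝ K) (hnt : K.Nontrivial) (hc : 1 < c)
    (hL : 0 < L) (hσ : 0 < σ) {P : ℕ → Finset (E n)} (hP : ValidPackings c L K σ P) :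
    ∃ k ε, Returns c L K σ P k ε := by
  have hl0 := lowerRate_pos hK hconv hnt hc hL hσ
  by_contra! hcon
  have hvis : ∀ k : ℕ, Visits c L K σ P k (2 ^ k * (2 * lowerRate c L K σ)) := fun k => by
    induction k with
    | zero => simpa using Visits.init
    | succ k ih =>
      have h1 : threshold c L K σ (2 ^ k * (2 * lowerRate c L K σ)) ≤
          Psi c K σ (2 ^ k * (2 * lowerRate c L K σ)) (P k) := by
        by_contra! hlt
        exact hcon _ _ ⟨ih, hlt⟩
      have e : (2 : ℝ) ^ (k + 1) * (2 * lowerRate c L K σ) =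
          2 * (2 ^ k * (2 * lowerRate c L K σ)) := by ring
      rw [e]
      exact Visits.loop ih h1
  obtain ⟨k, hk⟩ := pow_unbounded_of_one_lt (Metric.diam K * c / (2 * lowerRate c L K σ))
    (one_lt_two (α := ℝ))
  rw [div_lt_iff₀ (by positivity)] at hk
  refine hcon k _ ⟨hvis k, Psi_lt_threshold_of_diam_le hK hconv hnt hc hσ (by positivity) ?_
    (hP k _ (hvis k))⟩
  rw [le_div_iff₀ (by linarith)]
  exact hk.le

/-- The rate returned by the algorithm is at least of the order of the worst case rate. -/
lemma worstCaseRate_le_of_returns (hK : IsCompact K) (hconv : Convex ℝ K) (hnt : K.Nontrivial)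
    (hc : 1 < c) (hL : 0 < L) (hσ : 0 < σ) {P : ℕ → Finset (E n)} (hP : ValidPackings c L K σ P)
    {k : ℕ} {ε : ℝ} (h : Returns c L K σ P k ε) {κ : ℝ} (hκ : 0 ≤ κ)
    (hm : min σ (Metric.diam K) ≤ κ * ε) :
    worstCaseRate K σ ≤ (upperConst c L * (1 + κ) + κ) * ε := by
  have hl0 := lowerRate_pos hK hconv hnt hc hL hσ
  have hε : 2 * lowerRate c L K σ ≤ ε := by
    rw [h.1.eq]
    exact le_mul_of_one_le_left (by positivity) (one_le_pow₀ one_le_two)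
  have hε0 : 0 < ε := by linarith
  have hU : 0 < upperConst c L := by rw [upperConst]; positivity
  have h1 := worstCaseRate_le_of_Psi_lt hK hconv hnt hc hL hσ hε0 (by linarith) (hP k ε h.1) h.2
  have hκε : 0 ≤ κ * ε := by positivity
  rcases min_le_iff.1 hm with h2 | h2
  · have := mul_le_mul_of_nonneg_left h2 hU.le
    linarith
  · have h3 := worstCaseRate_le_diam (σ := σ) hK hconv hnt.nonempty
    have : 0 ≤ upperConst c L * (1 + κ) * ε := by positivity
    linarith

end Algorithm

end LSEPacking

end

/-! ### Assembly of the four cases. -/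

theorem theorem2p22 (c L : ℝ) (hc : 1 < c) (hL : 0 < L) :
    ∃ (A₀ : ℝ) (A : ℝ → ℝ), 0 < A₀ ∧ (∀ a, 0 < A a) ∧
      ∀ (n : ℕ) (K : Set (LSEPacking.E n)) (σ : ℝ),
        IsCompact K → Convex ℝ K → K.Nontrivial → 0 < σ →
        -- the algorithm can be executed
        (∃ P : ℕ → Finset (LSEPacking.E n), LSEPacking.ValidPackings c L K σ P) ∧
        ∀ P : ℕ → Finset (LSEPacking.E n), LSEPacking.ValidPackings c L K σ P →
          -- it terminates
          (∃ (k : ℕ) (ε : ℝ), LSEPacking.Returns c L K σ P k ε) ∧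
          ∀ (k : ℕ) (ε : ℝ), LSEPacking.Returns c L K σ P k ε →
            -- termination on initialization
            (k = 0 → LSEPacking.Comparable A₀ ε (LSEPacking.worstCaseRate K σ)) ∧
            ∀ a : ℝ, 0 < a →
              -- `d ≲ σ`
              (Metric.diam K ≤ a * σ →
                LSEPacking.Comparable (A a) (LSEPacking.worstCaseRate K σ) (Metric.diam K) ∧
                Metric.diam K ≤ A a * ε) ∧
              -- `d ≳ σ` and `σ ≥ ε`
              (σ ≤ a * Metric.diam K → ε ≤ σ →
                LSEPacking.Comparable (A a) ε (LSEPacking.worstCaseRate K σ) ∧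
                LSEPacking.Comparable (A a) (LSEPacking.worstCaseRate K σ)
                  (min σ (Metric.diam K))) ∧
              -- `d ≳ σ` and `σ ≤ ε`
              (σ ≤ a * Metric.diam K → σ ≤ ε →
                LSEPacking.Comparable (A a) ε (LSEPacking.worstCaseRate K σ)) := by
  have hc0 : 0 < c := by linarith
  have hC := LSEPacking.constC_pos hc0
  set κ₀ : ℝ := L / (c * LSEPacking.constC c + L) with hκ₀
  set κ₁ : ℝ := 8 * (c * LSEPacking.constC c + 3 * L) / LSEPacking.constC c with hκ₁
  have hκ₀0 : 0 < κ₀ := by positivity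
  have hκ₁0 : 0 < κ₁ := by positivity
  set A₁ : ℝ := LSEPacking.upperConst c L * (1 + 1 / κ₀) + 1 / κ₀ with hA₁
  have hU : 0 < LSEPacking.upperConst c L := by rw [LSEPacking.upperConst]; positivity
  have hA₁0 : 0 < A₁ := by positivity
  -- One sum dominates the constants of all cases. The terms `4 * c + 32` and `113` cover twice the
  -- constants `2 * c + 16` and `56` of the loop bound, the factor two being the last doubling;
  -- `|a|` keeps the value positive for every real `a`.
  refine ⟨A₁ + 2 * κ₁, fun a => A₁ + 1 + 2 * κ₁ + (4 * c + 32) + 113 * ((1 + |a|) * κ₁ / κ₀) +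
    (1 + |a|) / κ₀, by positivity, fun a => by positivity, ?_⟩
  intro n K σ hK hconv hnt hσ
  refine ⟨LSEPacking.exists_validPackings hK hconv hnt hc hL hσ, fun P hP =>
    ⟨LSEPacking.exists_returns hK hconv hnt hc hL hσ hP, fun k ε hret => ?_⟩⟩
  have hl0 := LSEPacking.lowerRate_pos hK hconv hnt hc hL hσ
  have hml := LSEPacking.min_le_lowerRate hK hconv hnt hc hL hσ
  have hlR := LSEPacking.lowerRate_le_worstCaseRate hK hconv hnt hc hL hσ
  rw [← hκ₀] at hml
  rw [← hκ₁] at hlR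
  have hRd := LSEPacking.worstCaseRate_le_diam (σ := σ) hK hconv hnt.nonempty
  have hR0 := LSEPacking.worstCaseRate_nonneg (K := K) (σ := σ)
  have hd := LSEPacking.diam_pos hK hnt
  set l := LSEPacking.lowerRate c L K σ with hl
  set R := LSEPacking.worstCaseRate K σ with hR
  set d := Metric.diam K with hdd
  have hm0 : 0 < min σ d := lt_min hσ hd
  have hεl : 2 * l ≤ ε := by
    rw [hret.1.eq]
    exact le_mul_of_one_le_left (by positivity) (one_le_pow₀ one_le_two)
  have hε0 : 0 < ε := by linarith
  have hml' : min σ d ≤ 1 / κ₀ * l := by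
    rw [one_div, inv_mul_eq_div, le_div_iff₀ hκ₀0]
    linarith
  have hmε : min σ d ≤ 1 / κ₀ * ε :=
    hml'.trans (mul_le_mul_of_nonneg_left (by linarith) (by positivity))
  have hmR : min σ d ≤ κ₁ / κ₀ * R := by
    refine hml'.trans ?_
    have := mul_le_mul_of_nonneg_left hlR (by positivity : 0 ≤ 1 / κ₀)
    refine this.trans (le_of_eq ?_)
    ring
  have hRε : R ≤ A₁ * ε :=
    LSEPacking.worstCaseRate_le_of_returns hK hconv hnt hc hL hσ hP hret (by positivity) hmε
  have hzero : k = 0 → ε ≤ 2 * κ₁ * R := by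
    rintro rfl
    rw [hret.1.eq, pow_zero, one_mul]
    linarith
  refine ⟨fun hk => ⟨?_, ?_⟩, fun a ha => ?_⟩
  · have := hzero hk
    have : 0 ≤ A₁ * R := by positivity
    linarith
  · have : 0 ≤ 2 * κ₁ * ε := by positivity
    linarith
  beta_reduce
  rw [abs_of_pos ha]
  set B : ℝ := (1 + a) * κ₁ / κ₀ with hB
  have hB0 : 0 < B := by positivity
  have hB' : 0 < (1 + a) / κ₀ := by positivity
  have hBm : (1 + a) * min σ d ≤ B * R := by
    have := mul_le_mul_of_nonneg_left hmR (by positivity : 0 ≤ 1 + a)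
    refine this.trans (le_of_eq ?_)
    rw [hB]
    ring
  have hκB : κ₁ / κ₀ * R ≤ B * R := by
    refine mul_le_mul_of_nonneg_right ?_ hR0
    rw [hB, mul_div_assoc]
    exact le_mul_of_one_le_left (by positivity) (by linarith)
  have expand : ∀ t : ℝ, 0 ≤ t → ∀ b : ℝ, b ≤ A₁ + 1 + 2 * κ₁ + (4 * c + 32) + 113 * B +
      (1 + a) / κ₀ → b * t ≤ (A₁ + 1 + 2 * κ₁ + (4 * c + 32) + 113 * B + (1 + a) / κ₀) * t :=
    fun t ht b hb => mul_le_mul_of_nonneg_right hb ht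
  refine ⟨fun hda => ?_, fun hσd hεσ => ?_, fun hσd hσε => ?_⟩
  · have hdm : d ≤ (1 + a) * min σ d := by
      rcases min_choice σ d with h | h <;> rw [h]
      · linarith
      · have : 0 < a * d := by positivity
        linarith
    refine ⟨⟨?_, ?_⟩, ?_⟩
    · have := expand d hd.le 1 (by linarith)
      linarith
    · have := expand R hR0 B (by linarith)
      linarith
    · have h1 := expand ε hε0.le ((1 + a) / κ₀) (by linarith)
      have h2 := mul_le_mul_of_nonneg_left hmε (by positivity : 0 ≤ 1 + a)
      have e : (1 + a) * (1 / κ₀ * ε) = (1 + a) / κ₀ * ε := by ring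
      linarith
  · have hσm : σ ≤ (1 + a) * min σ d := by
      rcases min_choice σ d with h | h <;> rw [h]
      · have : 0 < a * σ := by positivity
        linarith
      · linarith
    refine ⟨⟨?_, ?_⟩, ⟨?_, ?_⟩⟩
    · have := expand R hR0 B (by linarith)
      linarith
    · have := expand ε hε0.le A₁ (by linarith)
      linarith
    · have h1 := expand (min σ d) hm0.le (A₁ + 1) (by linarith)
      have h2 : R ≤ (A₁ + 1) * min σ d := by
        rcases min_choice σ d with h | h <;> rw [h]
        · have := mul_le_mul_of_nonneg_left hεσ hA₁0.le
          linarith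
        · have : 0 < A₁ * d := by positivity
          linarith
      linarith
    · have := expand R hR0 B (by linarith)
      linarith
  · have hσm : σ ≤ (1 + a) * min σ d := by
      rcases min_choice σ d with h | h <;> rw [h]
      · have : 0 < a * σ := by positivity
        linarith
      · linarith
    refine ⟨?_, ?_⟩
    · obtain ⟨hvis, -⟩ := hret
      -- Either the output is the starting value, or it is twice a scale at which the loop condition
      -- held; there the term in `σ` is absorbed by `σ ≤ (1 + a) * min σ d ≤ B * R`.
      cases hvis with
      | init =>
        have h1 := hzero rfl
        have h2 := expand R hR0 (2 * κ₁) (by linarith)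
        linarith
      | @loop j ε' hv hle =>
        have hε' : 2 * l ≤ ε' := by
          rw [hv.eq]
          exact le_mul_of_one_le_left (by positivity) (one_le_pow₀ one_le_two)
        have h1 := LSEPacking.le_worstCaseRate_of_threshold_le_Psi hK hconv hnt hc hL hσ hε'
          (hP j ε' hv) hle
        have h2 := expand R hR0 (4 * c + 32 + 112 * B) (by linarith)
        linarith
    · have := expand ε hε0.le A₁ (by linarith)
      linarith
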